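/- Let $d\ge 1$ and let $M_i,b_i$ be integers with $1\le b_i\le M_i$ for $i=1,\dots,d$. Put $\Lambda=\prod_{i=1}^d\{1,\dots,M_i\}$, $B=\prod_{i=1}^d\{1,\dots,b_i\}$ and $\Delta=\prod_{i=1}^d\{0,\dots,M_i-b_i\}$. Let $q:\mathbb Z^d\to\mathbb R$ be supported in $B$ and write $q_a(n)=q(n-a)$. Assume (H1) $q(x_1,\dots,x_i,\dots,x_d)=q(x_1,\dots,b_i-x_i+1,\dots,x_d)$ for all $x\in\mathbb Z^d$ and all $i$. Let $|\cdot|$ be the 1-norm on $\mathbb Z^d$ and let $(h_0u)(n)=-\sum_{|m-n|=1}u(m)$ on $\ell^2(\mathbb Z^d)$. For $\omega\in\Omega=\Delta^{\mathbb Z^d}$ put $V_\omega=\sum_{k\in\mathbb Z^d}q_{kM+\omega_k}$, where $kM=(k_iM_i)_{i=1}^d$, and let $h_\omega=h_0+V_\omega$, a bounded self-adjoint operator on $\ell^2(\mathbb Z^d)$ with spectrum $\sigma(h_\omega)\subset\mathbb R$. Let $\omega^*\in\Omega$ be the configuration with $(\omega^*_k)_i=0$ if $k_i$ is even and $(\omega^*_k)_i=M_i-b_i$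 if $k_i$ is odd. The Neumann Laplacian $h^N_{0,\Lambda}$ on $\ell^2(\Lambda)$ is given by the matrix with entries $-1$ at $(i,j)$ if $|i-j|=1$, $-\#\{j\in\mathbb Z^d\setminus\Lambda:|i-j|=1\}$ at $(i,i)$, and $0$ otherwise. For $a\in\Delta$ let $E_0(a)=\min\sigma(h^N_{0,\Lambda}+q_a)$ and $\tilde E_0(a)=\min\sigma(h^N_{0,\Lambda}-q_a)$. Let $\mu$ be a probability measure on $\Delta$ such that (H2) $\mu(\{n\})>0$ for every corner $n$ of $\Delta$, that is, for every $n\in\Delta$ with $n_i\in\{0,M_i-b_i\}$ for all $i$, and let $\mathbb P=\mu^{\otimes\mathbb Z^d}$ be the product measure on $\Omega$. Then there is exactly one closed set $\Sigma\subset\mathbb R$ (the almost-sure spectrum) with $\sigma(h_\omega)=\Sigma$ for $\mathbb P$-almost every $\omega$, and the following hold. (a) If either $d\ge2$ and $q$ is sign-definite ($q\ge0$ everywhere or $q\le0$ everywhere), or $d=1$ and $E_0(a)\ne-2$ for at least one $a\in\Delta$, then $\inf\Sigma=\min\sigma(h_{\omega^*})$. (b) If either $d\ge2$ and $q$ is sign-definite,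 or $d=1$ and $\tilde E_0(a)\ne-2$ for at least one $a\in\Delta$, then $\sup\Sigma=\max\sigma(h_{\omega^*})$. -/

import Mathlib

open MeasureTheory

noncomputable section

namespace DisplacementModel

/-- The lattice `ℤ^d`, with its coordinatewise order, so that `Finset.Icc` and `Set.Icc` are
boxes. -/
abbrev Lattice (d : ℕ) : Type := Fin d → ℤ

/-- The 1-norm of a lattice vector. -/
def norm1 {d : ℕ} (x : Lattice d) : ℤ := ∑ i, |x i|

/-- The nearest neighbours of the site `n`, i.e. all `m` with `|m - n| = 1` in the 1-norm. -/
def neighbors {d : ℕ} (n : Lattice d) : Finset (Lattice d) :=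
  (Finset.Icc (fun i => n i - 1) (fun i => n i + 1)).filter (fun m => norm1 (m - n) = 1)

theorem mem_neighbors {d : ℕ} {n m : Lattice d} : m ∈ neighbors n ↔ norm1 (m - n) = 1 := by
  unfold neighbors
  rw [Finset.mem_filter, Finset.mem_Icc]
  refine ⟨fun h => h.2, fun h => ⟨?_, h⟩⟩
  have key : ∀ i, |m i - n i| ≤ 1 := by
    intro i
    rw [← h]
    exact Finset.single_le_sum (f := fun i => |(m - n) i|) (fun j _ => abs_nonneg _)
      (Finset.mem_univ i)
  exact ⟨fun i => by have := abs_le.1 (key i); show n i - 1 ≤ m i; omega,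
    fun i => by have := abs_le.1 (key i); show m i ≤ n i + 1; omega⟩

/-- The Hilbert space `ℓ²(ℤ^d)`. -/
abbrev Ell2 (d : ℕ) : Type := lp (fun _ : Lattice d => ℂ) 2

theorem two_toReal_pos : (0 : ℝ) < (2 : ENNReal).toReal := by norm_num

/-- The translation `(shift v u)(n) = u(n + v)` on `ℓ²(ℤ^d)`. -/
def shift {d : ℕ} (v : Lattice d) : Ell2 d →L[ℂ] Ell2 d :=
  LinearMap.mkContinuousOfExistsBound
    { toFun := fun u => ⟨fun n => u (n + v), memℓp_gen
        (((lp.memℓp u).summable two_toReal_pos).comp_injective (add_left_injective v))⟩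
      map_add' := fun _ _ => rfl
      map_smul' := fun _ _ => rfl }
    ⟨1, fun u => by
      rw [one_mul]
      refine lp.norm_le_of_tsum_le two_toReal_pos (norm_nonneg u) ?_
      rw [lp.norm_rpow_eq_tsum two_toReal_pos u]
      exact ((Equiv.addRight v).tsum_eq (fun n => ‖u n‖ ^ (2 : ENNReal).toReal)).le⟩

theorem shift_apply {d : ℕ} (v : Lattice d) (u : Ell2 d) (n : Lattice d) :
    shift v u n = u (n + v) := rfl

/-- Multiplication by a bounded real function `V` on `ℓ²(ℤ^d)`. -/
def mulOp {d : ℕ} (V : Lattice d → ℝ) (hV : ∃ C, ∀ n, |V n| ≤ C) : Ell2 d →L[ℂ] Ell2 d :=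
  have bound : ∀ C, (∀ n, |V n| ≤ C) → ∀ (u : Ell2 d) (n : Lattice d),
      ‖(V n : ℂ) * u n‖ ≤ ‖(((C : ℝ) : ℂ) • u) n‖ := by
    intro C hC u n
    rw [lp.coeFn_smul, Pi.smul_apply, smul_eq_mul, norm_mul, norm_mul, Complex.norm_real,
      Complex.norm_real, Real.norm_eq_abs, Real.norm_eq_abs]
    exact mul_le_mul_of_nonneg_right ((hC n).trans (le_abs_self C)) (norm_nonneg _)
  have mem : ∀ u : Ell2 d, Memℓp (fun n => (V n : ℂ) * u n) 2 := by
    intro u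
    obtain ⟨C, hC⟩ := hV
    refine memℓp_gen (Summable.of_nonneg_of_le (fun n => by positivity)
      (fun n => Real.rpow_le_rpow (norm_nonneg _) (bound C hC u n) two_toReal_pos.le)
      ((lp.memℓp (((C : ℝ) : ℂ) • u)).summable two_toReal_pos))
  LinearMap.mkContinuousOfExistsBound
    { toFun := fun u => ⟨fun n => (V n : ℂ) * u n, mem u⟩
      map_add' := fun u v => by
        ext n
        exact mul_add _ _ _
      map_smul' := fun c u => by
        ext n
        exact mul_left_comm _ _ _ }
    (by
      obtain ⟨C, hC⟩ := hV
      refine ⟨‖((C : ℝ) : ℂ)‖, fun u => ?_⟩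
      rw [← norm_smul]
      exact lp.norm_mono (by norm_num) (fun n => bound C hC u n))

theorem mulOp_apply {d : ℕ} (V : Lattice d → ℝ) (hV : ∃ C, ∀ n, |V n| ≤ C) (u : Ell2 d)
    (n : Lattice d) : mulOp V hV u n = (V n : ℂ) * u n := rfl

/-- The (negative) discrete Laplacian `h₀` on `ℓ²(ℤ^d)`: minus the sum of the translations by the
unit vectors; see `laplacian_apply` for the formula `(h₀ u)(n) = - ∑_{|m-n|=1} u(m)`. -/
def laplacian (d : ℕ) : Ell2 d →L[ℂ] Ell2 d := -∑ v ∈ neighbors (0 : Lattice d), shift v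

theorem laplacian_apply {d : ℕ} (u : Ell2 d) (n : Lattice d) :
    laplacian d u n = -∑ m ∈ neighbors n, u m := by
  have h : laplacian d u n = -∑ v ∈ neighbors (0 : Lattice d), u (n + v) := by
    unfold laplacian
    rw [_root_.neg_apply, lp.coeFn_neg, Pi.neg_apply, _root_.sum_apply,
      lp.coeFn_sum, Finset.sum_apply]
    rfl
  rw [h]
  congr 1
  refine Finset.sum_bij' (fun v _ => n + v) (fun m _ => m - n) ?_ ?_ ?_ ?_ ?_
  · intro v hv
    rw [mem_neighbors] at hv ⊢
    simpa using hv
  · intro m hm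
    rw [mem_neighbors] at hm ⊢
    simpa using hm
  · intro v _
    simp
  · intro m _
    simp
  · intro v _
    rfl

/-- The number of nearest neighbours of `i` outside `Λ`. -/
def edgeCount {d : ℕ} (Λ : Finset (Lattice d)) (i : Lattice d) : ℕ :=
  ((neighbors i).filter (fun j => j ∉ Λ)).card

/-- The discrete Neumann Laplacian on a finite set `Λ ⊂ ℤ^d`, as a matrix indexed by `Λ`: the
truncation of `h₀` to `Λ` minus the edge counting operator. -/
def neumannLaplacian {d : ℕ} (Λ : Finset (Lattice d)) : Matrix Λ Λ ℝ :=
  Matrix.of (fun i j => if norm1 (i.1 - j.1) = 1 then -1 else 0)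
    - Matrix.diagonal (fun i => (edgeCount Λ i.1 : ℝ))

/-- The Neumann Laplacian on `Λ` plus the restriction of the potential `V` to `Λ`. -/
def neumannSchrodinger {d : ℕ} (Λ : Finset (Lattice d)) (V : Lattice d → ℝ) : Matrix Λ Λ ℝ :=
  neumannLaplacian Λ + Matrix.diagonal (fun i => V i.1)

/-- The least element of the spectrum of the Neumann Laplacian on `Λ` plus `V`; by
`groundEnergy_isLeast` it is attained for nonempty `Λ`. -/
def groundEnergy {d : ℕ} (Λ : Finset (Lattice d)) (V : Lattice d → ℝ) : ℝ :=
  sInf (spectrum ℝ (neumannSchrodinger Λ V))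

theorem norm1_sub_comm {d : ℕ} (x y : Lattice d) : norm1 (x - y) = norm1 (y - x) :=
  Finset.sum_congr rfl fun i _ => abs_sub_comm (x i) (y i)

theorem neumannSchrodinger_isHermitian {d : ℕ} (Λ : Finset (Lattice d)) (V : Lattice d → ℝ) :
    (neumannSchrodinger Λ V).IsHermitian := by
  unfold neumannSchrodinger neumannLaplacian
  refine Matrix.IsHermitian.add (Matrix.IsHermitian.sub ?_ ?_) ?_
  · refine Matrix.IsHermitian.ext fun i j => ?_
    rw [Matrix.of_apply, Matrix.of_apply, norm1_sub_comm, star_trivial]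
  · exact Matrix.isHermitian_diagonal _
  · exact Matrix.isHermitian_diagonal _

theorem groundEnergy_isLeast {d : ℕ} (Λ : Finset (Lattice d)) (hΛ : Λ.Nonempty)
    (V : Lattice d → ℝ) :
    IsLeast (spectrum ℝ (neumannSchrodinger Λ V)) (groundEnergy Λ V) := by
  have : Nonempty Λ := hΛ.to_subtype
  have hne : (spectrum ℝ (neumannSchrodinger Λ V)).Nonempty := by
    rw [(neumannSchrodinger_isHermitian Λ V).spectrum_real_eq_range_eigenvalues]
    exact Set.range_nonempty _
  have hfin : (spectrum ℝ (neumannSchrodinger Λ V)).Finite := Matrix.finite_real_spectrum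
  exact ⟨hne.csInf_mem hfin, fun x hx => csInf_le hfin.bddBelow hx⟩

/-- The data of a displacement model on `ℤ^d`: side lengths `1 ≤ b i ≤ M i` of the boxes
`B = ∏ [1, b i]` and `Λ = ∏ [1, M i]`, and a single-site potential `q` supported in `B`. -/
structure Model (d : ℕ) where
  M : Fin d → ℕ
  b : Fin d → ℕ
  one_le_b : ∀ i, 1 ≤ b i
  b_le_M : ∀ i, b i ≤ M i
  q : Lattice d → ℝ
  support_q : ∀ x, q x ≠ 0 → ∀ i, 1 ≤ x i ∧ x i ≤ b i

namespace Model

variable {d : ℕ} (D : Model d)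

/-- The box `Λ = ∏ [1, M i]`. -/
def box : Finset (Lattice d) := Finset.Icc (fun _ => 1) (fun i => (D.M i : ℤ))

/-- The set `Δ = ∏ [0, M i - b i]` of admissible displacements, as a type. -/
abbrev Displacement : Type := ↥(Set.Icc (fun _ => 0 : Lattice d) (fun i => (D.M i : ℤ) - D.b i))

/-- The set `Ω = Δ^(ℤ^d)` of displacement configurations. -/
abbrev Config : Type := Lattice d → D.Displacement

/-- Hypothesis (H1): `q` is reflection symmetric in each variable. -/
def ReflectionSymmetric : Prop :=
  ∀ (x : Lattice d) (i : Fin d), D.q x = D.q (Function.update x i (D.b i - x i + 1))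

/-- `q` has a sign: it is nonnegative everywhere or nonpositive everywhere. -/
def SignDefinite : Prop := (∀ x, 0 ≤ D.q x) ∨ (∀ x, D.q x ≤ 0)

/-- The translate `q_a(n) = q(n - a)`. -/
def translate (a : Lattice d) (n : Lattice d) : ℝ := D.q (n - a)

/-- `E₀(a)`, the spectral minimum of the Neumann Laplacian on `Λ` plus `q_a`. -/
def E0 (a : D.Displacement) : ℝ := groundEnergy D.box (D.translate a.1)

/-- The spectral minimum of the Neumann Laplacian on `Λ` minus `q_a`. -/
def E0neg (a : D.Displacement) : ℝ := groundEnergy D.box (fun n => -D.translate a.1 n)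

/-- The potential `V_ω = ∑_k q_{kM + ω_k}`; at every site at most one summand is nonzero. -/
def potential (ω : D.Config) (n : Lattice d) : ℝ :=
  ∑ᶠ k : Lattice d, D.translate (fun i => k i * D.M i + (ω k).1 i) n

theorem tile_unique {ω : D.Config} {n k l : Lattice d}
    (hk : D.translate (fun i => k i * D.M i + (ω k).1 i) n ≠ 0)
    (hl : D.translate (fun i => l i * D.M i + (ω l).1 i) n ≠ 0) : k = l := by
  have aux : ∀ m : Lattice d, D.translate (fun i => m i * D.M i + (ω m).1 i) n ≠ 0 →
      ∀ i, m i * D.M i + 1 ≤ n i ∧ n i ≤ m i * D.M i + D.M i := by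
    intro m hm i
    have h1 : 1 ≤ n i - (m i * D.M i + (ω m).1 i) ∧ n i - (m i * D.M i + (ω m).1 i) ≤ D.b i :=
      D.support_q _ hm i
    have h2 : (0 : ℤ) ≤ (ω m).1 i := (ω m).2.1 i
    have h3 : (ω m).1 i ≤ (D.M i : ℤ) - D.b i := (ω m).2.2 i
    constructor <;> linarith [h1.1, h1.2]
  funext i
  have hk' := aux k hk i
  have hl' := aux l hl i
  have hM : (0 : ℤ) ≤ D.M i := by positivity
  rcases lt_trichotomy (k i) (l i) with h | h | h
  · have := mul_le_mul_of_nonneg_right (Int.add_one_le_iff.2 h) hM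
    linarith [hk'.1, hk'.2, hl'.1, hl'.2]
  · exact h
  · have := mul_le_mul_of_nonneg_right (Int.add_one_le_iff.2 h) hM
    linarith [hk'.1, hk'.2, hl'.1, hl'.2]

theorem q_bounded : ∃ C, ∀ n, |D.q n| ≤ C := by
  have hfin : (Function.support D.q).Finite :=
    (Set.finite_Icc (fun _ => 1 : Lattice d) (fun i => (D.b i : ℤ))).subset
      fun x hx => ⟨fun i => (D.support_q x hx i).1, fun i => (D.support_q x hx i).2⟩
  obtain ⟨C, hC⟩ := (hfin.image (fun x => |D.q x|)).bddAbove
  refine ⟨max C 0, fun n => ?_⟩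
  by_cases h : D.q n = 0
  · rw [h, abs_zero]
    exact le_max_right _ _
  · exact (hC ⟨n, h, rfl⟩).trans (le_max_left _ _)

theorem potential_bounded (ω : D.Config) : ∃ C, ∀ n, |D.potential ω n| ≤ C := by
  obtain ⟨C, hC⟩ := D.q_bounded
  refine ⟨C, fun n => ?_⟩
  unfold potential
  by_cases h : ∃ k : Lattice d, D.translate (fun i => k i * D.M i + (ω k).1 i) n ≠ 0
  · obtain ⟨k, hk⟩ := h
    rw [finsum_eq_single _ k (fun l hl => by
      by_contra hne
      exact hl (D.tile_unique hne hk))]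
    exact hC _
  · push Not at h
    rw [finsum_congr h, finsum_zero, abs_zero]
    exact (abs_nonneg _).trans (hC 0)

/-- The bounded operator `h_ω = h₀ + V_ω` on `ℓ²(ℤ^d)`. -/
def hamiltonian (ω : D.Config) : Ell2 d →L[ℂ] Ell2 d :=
  laplacian d + mulOp (D.potential ω) (D.potential_bounded ω)

/-- The real spectrum of `h_ω`: all real `E` such that `h_ω - E` has no bounded inverse. As `h_ω`
is self-adjoint, this is its whole spectrum. -/
def spec (ω : D.Config) : Set ℝ := spectrum ℝ (D.hamiltonian ω)

/-- The configuration `ω*`: coordinate `i` of `ω*_k` is `0` if `k i` is even, and `M i - b i` if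
`k i` is odd. -/
def omegaStar : D.Config := fun k =>
  ⟨fun i => if Even (k i) then 0 else (D.M i : ℤ) - D.b i, by
    have hb : ∀ i, (D.b i : ℤ) ≤ D.M i := fun i => by exact_mod_cast D.b_le_M i
    constructor
    · intro i
      show (0 : ℤ) ≤ if Even (k i) then 0 else (D.M i : ℤ) - D.b i
      have := hb i
      split_ifs <;> omega
    · intro i
      show (if Even (k i) then 0 else (D.M i : ℤ) - D.b i) ≤ (D.M i : ℤ) - D.b i
      have := hb i
      split_ifs <;> omega⟩

/-- The corners of `Δ`. -/
def IsCorner (n : D.Displacement) : Prop := ∀ i, n.1 i = 0 ∨ n.1 i = (D.M i : ℤ) - D.b i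

/-- Hypothesis (H2): every corner of `Δ` has positive probability. -/
def CornersCharged (μ : Measure D.Displacement) : Prop := ∀ n, D.IsCorner n → 0 < μ {n}

/-- The law on `Ω` under which the displacements `ω_k` are independent with distribution `μ`. -/
def law (μ : Measure D.Displacement) [IsProbabilityMeasure μ] : Measure D.Config :=
  Measure.infinitePi (fun _ : Lattice d => μ)

/-- `S` is the almost-sure spectrum of the random displacement model with single-site
distribution `μ`. -/
def IsAlmostSureSpectrum (μ : Measure D.Displacement) [IsProbabilityMeasure μ] (S : Set ℝ) :
    Prop :=
  IsClosed S ∧ ∀ᵐ ω ∂(D.law μ), D.spec ω = S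

end Model

end DisplacementModel

end

/-! Both `inf Σ` and the bottom of `σ(h_{ω*})` equal the box energy `E0` at displacement `0`.

Lower bound, for every configuration. Written as a sum over bonds, the energy splits into the
Neumann energies of the tiles plus nonnegative terms for the bonds between tiles, so the spectrum
lies above `min_a E0(a)` (`mul_tsum_sq_le`, `le_of_mem_spec`). That minimum is attained at `a = 0`
(`E0_zero_le`). Let `a` be a minimiser whose coordinate `i` is interior. Slide its ground state one
step up or down in direction `i`, dropping one end layer of the box and repeating the other. This
gives trial functions for `a ± e_i` whose energies add up to at most twice the original energy,
while their squared norms add up to exactly twice the original. Hence `a - e_i` is again a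
minimiser. Descending in this way, and reflecting a coordinate that sits at its upper end, leads to
`0`.

Attainment. By reflection symmetry the potential of `ω*` is the box potential unfolded by repeated
reflection. The Neumann ground state unfolds to a bounded generalised eigenfunction, and Schnol's
theorem puts `E0(0)` in the spectrum (`E0_zero_mem_spec_omegaStar`).

Randomness. By Borel–Cantelli, almost every configuration contains every finite pattern of charged
displacements. Weyl sequences can be chosen finitely supported, so such a configuration has all the
spectrum of any charged one. This makes the spectrum almost surely constant, and it contains
`σ(h_{ω*})` because the corners are charged.

Upper edge. Conjugation by the checkerboard sign turns `h₀ + V` into `-(h₀ - V)`, which reduces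
suprema to infima for the potential `-q`. -/

open MeasureTheory

noncomputable section

namespace DisplacementModel

variable {d : ℕ}

/-! ### Weyl's criterion with finitely supported real functions -/

/-- The action of `h₀ + V` on a real-valued lattice function. -/
def schr (V : Lattice d → ℝ) (u : Lattice d → ℝ) (n : Lattice d) : ℝ :=
  -∑ m ∈ neighbors n, u m + V n * u n

/-- `E` is an approximate eigenvalue of `h₀ + V`, witnessed by finitely supported real functions. -/
def IsApproxEigenvalue (V : Lattice d → ℝ) (E : ℝ) : Prop :=
  ∀ ε > 0, ∃ u : Lattice d → ℝ, u.support.Finite ∧ u ≠ 0 ∧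
    ∑' n, (schr V u n - E * u n) ^ 2 ≤ ε * ∑' n, u n ^ 2

theorem neighbors_comm {n m : Lattice d} : m ∈ neighbors n ↔ n ∈ neighbors m := by
  rw [mem_neighbors, mem_neighbors, norm1_sub_comm]

theorem sum_neighbors {α : Type*} [AddCommMonoid α] (f : Lattice d → α) (n : Lattice d) :
    ∑ m ∈ neighbors n, f m = ∑ v ∈ neighbors (0 : Lattice d), f (n + v) := by
  symm
  refine Finset.sum_bij' (fun v _ => n + v) (fun m _ => m - n) ?_ ?_ ?_ ?_ ?_
  · intro v hv
    rw [mem_neighbors] at hv ⊢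
    simpa using hv
  · intro m hm
    rw [mem_neighbors] at hm ⊢
    simpa using hm
  all_goals intros; simp

theorem card_neighbors (n : Lattice d) :
    (neighbors n).card = (neighbors (0 : Lattice d)).card := by
  rw [Finset.card_eq_sum_ones, Finset.card_eq_sum_ones, sum_neighbors]

theorem neg_mem_neighbors_zero {v : Lattice d} :
    -v ∈ neighbors (0 : Lattice d) ↔ v ∈ neighbors (0 : Lattice d) := by
  simp only [mem_neighbors, sub_zero, norm1, Pi.neg_apply, abs_neg]

theorem finite_support_schr {V u : Lattice d → ℝ} (hu : u.support.Finite) :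
    (schr V u).support.Finite := by
  refine (hu.union (hu.biUnion fun m _ => (neighbors m).finite_toSet)).subset fun n hn => ?_
  by_contra h
  simp only [Set.mem_union, Set.mem_iUnion, not_or, not_exists, Function.mem_support,
    not_not] at h
  refine hn ?_
  rw [schr, h.1, mul_zero, add_zero, neg_eq_zero]
  refine Finset.sum_eq_zero fun m hm => ?_
  by_contra hne
  exact h.2 m hne (neighbors_comm.1 hm)

theorem finite_support_schr_sub {V u : Lattice d → ℝ} (E : ℝ) (hu : u.support.Finite) :
    (fun n => schr V u n - E * u n).support.Finite := by
  refine ((finite_support_schr (V := V) hu).union hu).subset fun n hn => ?_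
  by_contra h
  simp only [Set.mem_union, Function.mem_support, not_or, not_not] at h
  exact hn (by simp [h.1, h.2])

theorem summable_sq {u : Lattice d → ℝ} (hu : u.support.Finite) :
    Summable fun n => u n ^ 2 :=
  summable_of_hasFiniteSupport (hu.subset fun n hn h => hn (by simp [h]))

theorem norm_sq_eq (v : Ell2 d) : ‖v‖ ^ 2 = ∑' n, ‖v n‖ ^ 2 := by
  have := lp.norm_rpow_eq_tsum two_toReal_pos v
  simpa using this

/-- A finitely supported real function as an element of `ℓ²`. -/
def toEll2 (u : Lattice d → ℝ) (hu : u.support.Finite) : Ell2 d :=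
  ⟨fun n => (u n : ℂ), memℓp_gen (summable_of_hasFiniteSupport (hu.subset fun n hn h => hn (by
    simp [h])))⟩

theorem norm_sq_toEll2 (u : Lattice d → ℝ) (hu : u.support.Finite) :
    ‖toEll2 u hu‖ ^ 2 = ∑' n, u n ^ 2 := by
  rw [norm_sq_eq]
  refine tsum_congr fun n => ?_
  change ‖((u n : ℝ) : ℂ)‖ ^ 2 = _
  rw [Complex.norm_real, Real.norm_eq_abs, sq_abs]

section Weyl

variable (V : Lattice d → ℝ) (hV : ∃ C, ∀ n, |V n| ≤ C) (E : ℝ)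

/-- The operator `h₀ + V - E`. -/
def shifted : Ell2 d →L[ℂ] Ell2 d :=
  laplacian d + mulOp V hV - (E : ℂ) • ContinuousLinearMap.id ℂ (Ell2 d)

theorem shifted_apply (v : Ell2 d) (n : Lattice d) :
    shifted V hV E v n = -∑ m ∈ neighbors n, v m + V n * v n - E * v n := by
  have : shifted V hV E v n = laplacian d v n + mulOp V hV v n - (E : ℂ) * v n := rfl
  rw [this, laplacian_apply, mulOp_apply]

theorem mem_spectrum_iff_not_isUnit_shifted :
    E ∈ spectrum ℝ (laplacian d + mulOp V hV) ↔ ¬ IsUnit (shifted V hV E) := by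
  rw [spectrum.mem_iff, ← IsUnit.neg_iff, neg_sub]
  have : algebraMap ℝ (Ell2 d →L[ℂ] Ell2 d) E = (E : ℂ) • ContinuousLinearMap.id ℂ (Ell2 d) := by
    rw [Algebra.algebraMap_eq_smul_one]
    ext v n
    rfl
  rw [this]
  rfl

theorem inner_shift (a : Lattice d) (u v : Ell2 d) :
    inner ℂ (shift a u) v = inner ℂ u (shift (-a) v) := by
  rw [lp.inner_eq_tsum, lp.inner_eq_tsum, ← (Equiv.addRight (-a)).tsum_eq]
  refine tsum_congr fun n => ?_
  simp [shift_apply]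

theorem inner_shifted (u v : Ell2 d) :
    inner ℂ (shifted V hV E u) v = inner ℂ u (shifted V hV E v) := by
  have h1 : inner ℂ (laplacian d u) v = inner ℂ u (laplacian d v) := by
    simp only [laplacian, _root_.neg_apply, _root_.sum_apply, inner_neg_left, inner_neg_right,
      sum_inner, inner_sum, inner_shift]
    congr 1
    exact Finset.sum_nbij' (fun v => -v) (fun v => -v) (fun v hv => neg_mem_neighbors_zero.2 hv)
      (fun v hv => neg_mem_neighbors_zero.2 hv) (by simp) (by simp) (by simp)
  have h2 : inner ℂ (mulOp V hV u) v = inner ℂ u (mulOp V hV v) := by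
    rw [lp.inner_eq_tsum, lp.inner_eq_tsum]
    refine tsum_congr fun n => ?_
    rw [mulOp_apply, mulOp_apply]
    simp [mul_assoc, mul_left_comm]
  simp only [shifted, _root_.sub_apply, _root_.add_apply, inner_sub_left, inner_sub_right,
    inner_add_left, inner_add_right, h1, h2]
  congr 1
  change inner ℂ ((E : ℂ) • u) v = inner ℂ u ((E : ℂ) • v)
  simp

/-- The lower bound makes `T` injective with closed range; by symmetry the orthogonal complement of
the range is the kernel, so the range is also dense. -/
theorem isUnit_of_bounded_below {T : Ell2 d →L[ℂ] Ell2 d}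
    (hT : ∀ u v, inner ℂ (T u) v = inner ℂ u (T v)) {c : ℝ} (hc : 0 < c)
    (h : ∀ u, c * ‖u‖ ^ 2 ≤ ‖T u‖ ^ 2) : IsUnit T := by
  have hanti : AntilipschitzWith (Real.toNNReal (Real.sqrt c)⁻¹) T := by
    refine AddMonoidHomClass.antilipschitz_of_bound T fun u => ?_
    have h0 := Real.sqrt_pos.2 hc
    rw [Real.coe_toNNReal _ (inv_pos.2 h0).le, ← div_eq_inv_mul, le_div_iff₀ h0]
    refine le_of_sq_le_sq ?_ (norm_nonneg _)
    rw [mul_pow, Real.sq_sqrt hc.le, mul_comm]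
    exact h u
  rw [ContinuousLinearMap.isUnit_iff_bijective,
    ContinuousLinearMap.bijective_iff_dense_range_and_antilipschitz]
  refine ⟨?_, _, hanti⟩
  rw [Submodule.topologicalClosure_eq_top_iff, Submodule.eq_bot_iff]
  intro w hw
  have hTw : T w = 0 := by
    rw [← inner_self_eq_zero (𝕜 := ℂ), hT]
    exact Submodule.inner_left_of_mem_orthogonal
      (LinearMap.mem_range_self (T : Ell2 d →ₗ[ℂ] Ell2 d) (T w)) hw
  have := hanti.injective (a₁ := w) (a₂ := 0) (by rw [hTw, map_zero])
  exact this

/-- The operator has real coefficients, so real and imaginary parts can be estimated separately;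
density of finitely supported vectors gives the bound on all of `ℓ²`. -/
theorem isUnit_shifted_of_bound {c : ℝ} (hc : 0 < c)
    (h : ∀ u : Lattice d → ℝ, u.support.Finite →
      c * ∑' n, u n ^ 2 ≤ ∑' n, (schr V u n - E * u n) ^ 2) : IsUnit (shifted V hV E) := by
  classical
  refine isUnit_of_bounded_below (inner_shifted V hV E) hc fun v => ?_
  have hfin : ∀ v : Ell2 d, (Function.support fun n => v n).Finite →
      c * ‖v‖ ^ 2 ≤ ‖shifted V hV E v‖ ^ 2 := by
    intro v hv
    have hre : (fun n => (v n).re).support.Finite :=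
      hv.subset fun n hn h0 => hn (by change v n = 0 at h0; simp [h0])
    have him : (fun n => (v n).im).support.Finite :=
      hv.subset fun n hn h0 => hn (by change v n = 0 at h0; simp [h0])
    have e1 : ‖v‖ ^ 2 = ∑' n, (v n).re ^ 2 + ∑' n, (v n).im ^ 2 := by
      rw [norm_sq_eq, ← (summable_sq hre).tsum_add (summable_sq him)]
      refine tsum_congr fun n => ?_
      rw [← Complex.normSq_eq_norm_sq, Complex.normSq_apply]
      ring
    have e2 : ‖shifted V hV E v‖ ^ 2 =
        ∑' n, (schr V (fun n => (v n).re) n - E * (v n).re) ^ 2 +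
        ∑' n, (schr V (fun n => (v n).im) n - E * (v n).im) ^ 2 := by
      rw [norm_sq_eq, ← (summable_sq (finite_support_schr_sub E hre)).tsum_add
        (summable_sq (finite_support_schr_sub E him))]
      refine tsum_congr fun n => ?_
      rw [← Complex.normSq_eq_norm_sq, Complex.normSq_apply, shifted_apply, schr, schr]
      simp
      ring
    rw [e1, e2, mul_add]
    exact add_le_add (h _ hre) (h _ him)
  have hlim := lp.hasSum_single (p := 2) (by norm_num) v
  refine le_of_tendsto_of_tendsto (((continuous_const.mul (continuous_norm.pow 2)).tendsto
    v).comp hlim) ((((continuous_norm.pow 2).comp (shifted V hV E).continuous).tendsto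
    v).comp hlim) (Filter.Eventually.of_forall fun s => hfin _ ?_)
  refine s.finite_toSet.subset fun n hn => ?_
  by_contra hns
  refine hn ?_
  change (∑ i ∈ s, lp.single 2 i (v i) : Ell2 d) n = 0
  rw [lp.coeFn_sum, Finset.sum_apply]
  refine Finset.sum_eq_zero fun i hi => ?_
  rw [lp.single_apply_ne]
  rintro rfl
  exact hns hi

/-- Weyl's criterion for discrete Schrödinger operators. -/
theorem mem_spectrum_iff : E ∈ spectrum ℝ (laplacian d + mulOp V hV) ↔ IsApproxEigenvalue V E := by
  rw [mem_spectrum_iff_not_isUnit_shifted]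
  constructor
  · intro hnu ε hε
    by_contra hcon
    refine hnu (isUnit_shifted_of_bound V hV E hε fun u hu => ?_)
    by_cases h0 : u = 0
    · subst h0
      simpa using tsum_nonneg fun n => sq_nonneg _
    · push Not at hcon
      exact (hcon u hu h0).le
  · rintro happ hu
    obtain ⟨S, hS⟩ := hu.exists_left_inv
    -- This tolerance times `‖S‖ ^ 2` is below `1`, which contradicts `u = S (h₀ + V - E) u` for `u
    -- ≠ 0`.
    have hpos : 0 < 1 / (2 * (‖S‖ ^ 2 + 1)) := by positivity
    obtain ⟨u, hfin, hne, hle⟩ := happ _ hpos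
    have hs : S (shifted V hV E (toEll2 u hfin)) = toEll2 u hfin := by
      rw [← mul_apply_eq_comp, hS]
      rfl
    have e : ‖shifted V hV E (toEll2 u hfin)‖ ^ 2 = ∑' n, (schr V u n - E * u n) ^ 2 := by
      rw [norm_sq_eq]
      refine tsum_congr fun n => ?_
      rw [shifted_apply, ← sq_abs (_ - _), ← Real.norm_eq_abs, ← Complex.norm_real]
      simp [schr, toEll2]
    have hb : ‖toEll2 u hfin‖ ^ 2 ≤ ‖S‖ ^ 2 * ‖shifted V hV E (toEll2 u hfin)‖ ^ 2 := by
      rw [← mul_pow]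
      refine pow_le_pow_left₀ (norm_nonneg _) ?_ 2
      conv_lhs => rw [← hs]
      exact S.le_opNorm _
    rw [e, norm_sq_toEll2] at hb
    have hp : 0 < ∑' n, u n ^ 2 := by
      obtain ⟨n, hn⟩ := Function.ne_iff.1 hne
      refine (summable_sq hfin).tsum_pos (fun n => sq_nonneg _) n ?_
      have : u n ≠ 0 := hn
      positivity
    have h2 := hb.trans (mul_le_mul_of_nonneg_left hle (sq_nonneg ‖S‖))
    have h3 : ‖S‖ ^ 2 * (1 / (2 * (‖S‖ ^ 2 + 1))) < 1 := by
      rw [mul_one_div, div_lt_one (by positivity)]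
      nlinarith [sq_nonneg ‖S‖]
    nlinarith

end Weyl

theorem Model.mem_spec_iff (D : Model d) (ω : D.Config) (E : ℝ) :
    E ∈ D.spec ω ↔ IsApproxEigenvalue (D.potential ω) E :=
  mem_spectrum_iff _ _ _


/-! ### Tiles and finite patterns -/

namespace Model

variable (D : Model d)

/-- The lower left corner `kM` of the tile with index `k`. -/
def origin (k : Lattice d) : Lattice d := fun i => k i * D.M i

/-- The index of the tile containing the site `n`. -/
def tile (n : Lattice d) : Lattice d := fun i => (n i - 1) / D.M i

theorem M_pos (i : Fin d) : (0 : ℤ) < D.M i := by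
  have := D.one_le_b i
  have := D.b_le_M i
  omega

theorem mem_box {n : Lattice d} : n ∈ D.box ↔ ∀ i, 1 ≤ n i ∧ n i ≤ D.M i := by
  rw [box, Finset.mem_Icc, Pi.le_def, Pi.le_def, forall_and]

theorem sub_origin_tile_mem_box (n : Lattice d) : n - D.origin (D.tile n) ∈ D.box := by
  rw [mem_box]
  intro i
  have h1 := Int.emod_add_mul_ediv (n i - 1) (D.M i)
  have h2 := Int.emod_nonneg (n i - 1) (D.M_pos i).ne'
  have h3 := Int.emod_lt_of_pos (n i - 1) (D.M_pos i)
  simp only [Pi.sub_apply, origin, tile]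
  rw [mul_comm]
  constructor <;> linarith

theorem tile_eq_of_mem {n k : Lattice d} (h : n - D.origin k ∈ D.box) : D.tile n = k := by
  funext i
  obtain ⟨h1, h2⟩ := D.mem_box.1 h i
  simp only [Pi.sub_apply, origin] at h1 h2
  refine (Int.ediv_eq_iff_of_pos (D.M_pos i)).2 ⟨?_, ?_⟩ <;> linarith

theorem tile_add_origin (n k : Lattice d) : D.tile (n + D.origin k) = D.tile n + k := by
  refine D.tile_eq_of_mem ?_
  convert! D.sub_origin_tile_mem_box n using 1
  funext i
  simp only [Pi.sub_apply, Pi.add_apply, origin]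
  ring

theorem tile_of_mem_box {n : Lattice d} (hn : n ∈ D.box) : D.tile n = 0 := by
  refine D.tile_eq_of_mem ?_
  convert hn using 1
  funext i
  simp [origin]

/-- Sites are parametrised by a tile and a site of the box. -/
def tileEquiv : Lattice d × D.box ≃ Lattice d where
  toFun p := p.2.1 + D.origin p.1
  invFun n := (D.tile n, ⟨n - D.origin (D.tile n), D.sub_origin_tile_mem_box n⟩)
  left_inv p := by
    have h : D.tile (p.2.1 + D.origin p.1) = p.1 := by
      rw [tile_add_origin, D.tile_of_mem_box p.2.2, zero_add]
    ext1
    · exact h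
    · ext1
      simp only [h, add_sub_cancel_right]
  right_inv n := by simp

theorem translate_eq_zero {a : D.Displacement} {n : Lattice d} (hn : n ∉ D.box) :
    D.translate a.1 n = 0 := by
  by_contra h
  refine hn (D.mem_box.2 fun i => ?_)
  have h1 := D.support_q _ h i
  have h2 : (0 : ℤ) ≤ a.1 i := a.2.1 i
  have h3 : a.1 i ≤ (D.M i : ℤ) - D.b i := a.2.2 i
  simp only [Pi.sub_apply] at h1
  constructor <;> linarith [h1.1, h1.2]

theorem potential_add_origin {ω : D.Config} {n : Lattice d} (hn : n ∈ D.box) (k : Lattice d) :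
    D.potential ω (n + D.origin k) = D.translate (ω k).1 n := by
  have key : ∀ l, D.translate (fun i => l i * D.M i + (ω l).1 i) (n + D.origin k) =
      D.translate (ω l).1 (n + D.origin k - D.origin l) := by
    intro l
    unfold translate
    congr 1
    funext i
    simp only [Pi.sub_apply, Pi.add_apply, origin]
    ring
  unfold potential
  simp only [key]
  rw [finsum_eq_single _ k, add_sub_cancel_right]
  intro l hl
  refine D.translate_eq_zero fun hmem => hl ?_
  rw [← D.tile_eq_of_mem hmem, tile_add_origin, D.tile_of_mem_box hn, zero_add]

theorem potential_eq (ω : D.Config) (n : Lattice d) :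
    D.potential ω n = D.translate (ω (D.tile n)).1 (n - D.origin (D.tile n)) := by
  rw [← D.potential_add_origin (D.sub_origin_tile_mem_box n), sub_add_cancel]

theorem potential_shift {ω ω' : D.Config} {n k : Lattice d}
    (h : ω' (D.tile n + k) = ω (D.tile n)) :
    D.potential ω' (n + D.origin k) = D.potential ω n := by
  rw [potential_eq, potential_eq, tile_add_origin, h]
  congr 1
  funext i
  simp only [Pi.sub_apply, Pi.add_apply, origin]
  ring

/-- If every finite pattern of `ω` occurs in `ω'`, the spectrum for `ω` is contained in the one
for `ω'`. -/
theorem spec_subset_of_patterns {ω ω' : D.Config}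
    (h : ∀ F : Finset (Lattice d), ∃ k, ∀ j ∈ F, ω' (j + k) = ω j) :
    D.spec ω ⊆ D.spec ω' := by
  intro E hE
  rw [mem_spec_iff] at hE ⊢
  intro ε hε
  obtain ⟨u, hfin, hne, hle⟩ := hE ε hε
  -- The potential enters only through `V n * u n`, so it must be matched only on the tiles that
  -- meet the support of `u`.
  obtain ⟨k, hk⟩ := h (hfin.toFinset.image D.tile)
  refine ⟨fun n => u (n - D.origin k), ?_, ?_, ?_⟩
  · exact hfin.preimage (f := fun n => n - D.origin k) (sub_left_injective.injOn)
  · obtain ⟨n, hn⟩ := Function.ne_iff.1 hne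
    exact Function.ne_iff.2 ⟨n + D.origin k, by simpa using hn⟩
  · rw [← (Equiv.addRight (D.origin k)).tsum_eq]
    rw [← (Equiv.addRight (D.origin k)).tsum_eq (fun n => u (n - D.origin k) ^ 2)]
    simp only [Equiv.coe_addRight, add_sub_cancel_right]
    convert hle using 5 with n
    rw [schr, schr, sum_neighbors, sum_neighbors _ n]
    congr 1
    · congr 1
      refine Finset.sum_congr rfl fun v _ => congrArg u ?_
      abel
    · rw [add_sub_cancel_right]
      by_cases hn : u n = 0
      · rw [hn, mul_zero, mul_zero]
      · rw [D.potential_shift (hk _ (Finset.mem_image_of_mem _ (by simpa using hn)))]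

end Model


/-! ### The almost-sure spectrum -/

namespace Model

variable (D : Model d)

instance : Finite D.Displacement := (Set.finite_Icc _ _).to_subtype

instance : Nonempty D.Displacement := ⟨D.omegaStar 0⟩

variable (μ : Measure D.Displacement)

/-- The event that the pattern `p` on `F` occurs at the place `k`. -/
def occurs (F : Finset (Lattice d)) (p : Lattice d → D.Displacement) (k : Lattice d) :
    Set D.Config := {ω | ∀ j ∈ F, ω (j + k) = p j}

/-- The displacements of `ω` are charged by `μ`. -/
def IsCharged (ω : D.Config) : Prop := ∀ k, 0 < μ {ω k}

/-- `ω` is charged and contains every finite charged pattern. -/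
def IsGeneric (ω : D.Config) : Prop :=
  D.IsCharged μ ω ∧ ∀ ω' : D.Config, D.IsCharged μ ω' → ∀ F, ∃ k, ω ∈ D.occurs F ω' k

variable {μ} in
theorem IsGeneric.spec_subset {ω ω' : D.Config} (h : D.IsGeneric μ ω)
    (h' : D.IsCharged μ ω') : D.spec ω' ⊆ D.spec ω :=
  D.spec_subset_of_patterns fun F => h.2 ω' h' F

variable {μ} in
theorem IsGeneric.spec_eq {ω ω' : D.Config} (h : D.IsGeneric μ ω)
    (h' : D.IsGeneric μ ω') : D.spec ω = D.spec ω' :=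
  (h'.spec_subset D h.1).antisymm (h.spec_subset D h'.1)

variable {μ} in
theorem isCharged_omegaStar (H2 : D.CornersCharged μ) : D.IsCharged μ D.omegaStar := by
  intro k
  refine H2 _ fun i => ?_
  change (if Even (k i) then (0 : ℤ) else _) = 0 ∨ (if Even (k i) then (0 : ℤ) else _) = _
  split_ifs
  · exact Or.inl rfl
  · exact Or.inr rfl

variable [IsProbabilityMeasure μ]

instance : IsProbabilityMeasure (D.law μ) := by
  unfold law
  infer_instance

theorem measurableSet_occurs (F : Finset (Lattice d)) (p : Lattice d → D.Displacement)
    (k : Lattice d) : MeasurableSet (D.occurs F p k) := by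
  have : D.occurs F p k = ⋂ j ∈ F, (fun ω : D.Config => ω (j + k)) ⁻¹' {p j} := by
    ext ω
    simp [occurs]
  rw [this]
  exact F.measurableSet_biInter fun j _ => measurable_pi_apply _ (MeasurableSet.of_discrete)

/-- The hypothesis on `k` makes the translates `F + k n` disjoint, so the intersection is a cylinder
set over their union. Independence and the common probability of the events are both read off from
this formula. -/
theorem law_biInter_occurs (F : Finset (Lattice d)) (p : Lattice d → D.Displacement)
    {k : ℕ → Lattice d} (hk : ∀ n m, ∀ j ∈ F, ∀ l ∈ F, j + k n = l + k m → n = m)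
    (s : Finset ℕ) :
    D.law μ (⋂ n ∈ s, D.occurs F p (k n)) = ∏ _n ∈ s, ∏ j ∈ F, μ {p j} := by
  classical
  -- The condition that the patterns impose at the site `l`; by disjointness at most one `n`
  -- contributes.
  let t : Lattice d → Set D.Displacement :=
    fun l => {a | ∀ n ∈ s, l - k n ∈ F → a = p (l - k n)}
  have hset : (⋂ n ∈ s, D.occurs F p (k n)) =
      ((s.biUnion fun n => F.image (· + k n) : Finset (Lattice d)) : Set (Lattice d)).pi t := by
    ext ω
    simp only [Set.mem_iInter, occurs, Set.mem_ofPred_eq, Set.mem_pi, Finset.mem_coe,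
      Finset.mem_biUnion, Finset.mem_image, t]
    constructor
    · rintro h _ - m hm hF
      have := h m hm _ hF
      rwa [sub_add_cancel] at this
    · intro h n hn j hj
      have := h (j + k n) ⟨n, hn, j, hj, rfl⟩ n hn (by simpa using hj)
      simpa using this
  rw [hset, law, Measure.infinitePi_pi _ fun _ _ => MeasurableSet.of_discrete,
    Finset.prod_biUnion]
  · refine Finset.prod_congr rfl fun n hn => ?_
    rw [Finset.prod_image (by simp)]
    refine Finset.prod_congr rfl fun j hj => congrArg μ ?_
    ext a
    simp only [t, Set.mem_ofPred_eq, Set.mem_singleton_iff]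
    constructor
    · intro h
      simpa using h n hn (by simpa using hj)
    · rintro rfl m - hF
      obtain rfl := hk n m j hj _ hF (by abel)
      simp
  · intro n _ m _ hnm
    refine Finset.disjoint_left.2 fun x hx hx' => hnm ?_
    obtain ⟨j, hj, rfl⟩ := Finset.mem_image.1 hx
    obtain ⟨l, hl, e⟩ := Finset.mem_image.1 hx'
    exact hk n m j hj l hl e.symm

/-- Disjoint translates of the pattern give infinitely many independent events of equal positive
probability, so the second Borel–Cantelli lemma applies. -/
theorem ae_exists_occurs (hd : 1 ≤ d) (F : Finset (Lattice d)) (p : Lattice d → D.Displacement)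
    (hp : ∀ j ∈ F, 0 < μ {p j}) : ∀ᵐ ω ∂D.law μ, ∃ k, ω ∈ D.occurs F p k := by
  let i₀ : Fin d := ⟨0, hd⟩
  let R : ℤ := ∑ j ∈ F, |j i₀|
  -- The first coordinates on `F` lie in `[-R, R]`, so the spacing `2 * R + 1` separates the
  -- translates.
  let k : ℕ → Lattice d := fun n _ => n * (2 * R + 1)
  have hR : ∀ j ∈ F, |j i₀| ≤ R := fun j hj =>
    Finset.single_le_sum (f := fun j : Lattice d => |j i₀|) (fun _ _ => abs_nonneg _) hj
  have hk : ∀ n m, ∀ j ∈ F, ∀ l ∈ F, j + k n = l + k m → n = m := by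
    intro n m j hj l hl h
    have h0 : j i₀ + n * (2 * R + 1) = l i₀ + m * (2 * R + 1) := congrFun h i₀
    have hj' := abs_le.1 (hR j hj)
    have hl' := abs_le.1 (hR l hl)
    have hR0 : 0 ≤ R := (abs_nonneg _).trans (hR j hj)
    rcases lt_trichotomy (n : ℤ) m with hlt | heq | hlt
    · have : (0 : ℤ) ≤ (m - n - 1) * (2 * R + 1) := mul_nonneg (by omega) (by omega)
      nlinarith
    · exact_mod_cast heq
    · have : (0 : ℤ) ≤ (n - m - 1) * (2 * R + 1) := mul_nonneg (by omega) (by omega)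
      nlinarith
  have hind : ProbabilityTheory.iIndepSet (fun n => D.occurs F p (k n)) (D.law μ) := by
    rw [ProbabilityTheory.iIndepSet_iff_meas_biInter fun n => D.measurableSet_occurs F p (k n)]
    intro s
    rw [D.law_biInter_occurs μ F p hk]
    refine Finset.prod_congr rfl fun n _ => ?_
    have := D.law_biInter_occurs μ F p hk {n}
    simpa using this.symm
  have hone := ProbabilityTheory.measure_limsup_eq_one
    (fun n => D.measurableSet_occurs F p (k n)) hind (by
      have : ∀ n, D.law μ (D.occurs F p (k n)) = ∏ j ∈ F, μ {p j} := by
        intro n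
        have := D.law_biInter_occurs μ F p hk {n}
        simpa using this
      simp only [this]
      exact ENNReal.tsum_const_eq_top_of_ne_zero
        (Finset.prod_ne_zero_iff.2 fun j hj => (hp j hj).ne'))
  have hae : ∀ᵐ ω ∂D.law μ, ω ∈ Filter.limsup (fun n => D.occurs F p (k n)) Filter.atTop :=
    (prob_compl_eq_zero_iff₀ (MeasurableSet.measurableSet_limsup
      fun n => D.measurableSet_occurs F p (k n)).nullMeasurableSet).2 hone
  filter_upwards [hae] with ω hω
  rw [Filter.mem_limsup_iff_frequently_mem] at hω
  obtain ⟨n, hn⟩ := hω.exists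
  exact ⟨k n, hn⟩

theorem ae_isCharged : ∀ᵐ ω ∂D.law μ, D.IsCharged μ ω := by
  refine ae_all_iff.2 fun k => ?_
  have h : ∀ᵐ a ∂μ, 0 < μ {a} := by
    rw [ae_iff]
    have : {a | ¬ 0 < μ {a}} = ⋃ a ∈ {a | ¬ 0 < μ {a}}, {a} :=
      (Set.biUnion_of_singleton _).symm
    rw [this]
    exact (measure_biUnion_null_iff (Set.to_countable _)).2 fun a ha => by simpa using ha
  exact (measurePreserving_eval_infinitePi (fun _ : Lattice d => μ)
    k).quasiMeasurePreserving.ae h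

theorem ae_isGeneric (hd : 1 ≤ d) : ∀ᵐ ω ∂D.law μ, D.IsGeneric μ ω := by
  classical
  -- Patterns are taken as functions on `F` itself: these form a countable family, so the
  -- quantifiers may be exchanged with "almost every".
  have h : ∀ᵐ ω ∂D.law μ, ∀ (F : Finset (Lattice d)) (p : F → {a : D.Displacement // 0 < μ {a}}),
      ∃ k, ∀ j : F, ω (j + k) = (p j).1 := by
    refine ae_all_iff.2 fun F => ae_all_iff.2 fun p => ?_
    filter_upwards [D.ae_exists_occurs μ hd F
      (fun j => if h : j ∈ F then (p ⟨j, h⟩).1 else Classical.arbitrary _)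
      (fun j hj => by simpa [hj] using (p ⟨j, hj⟩).2)] with ω ⟨k, hk⟩
    refine ⟨k, fun j => ?_⟩
    have := hk j.1 j.2
    simpa using this
  filter_upwards [D.ae_isCharged μ, h] with ω h1 h2
  refine ⟨h1, fun ω' hω' F => ?_⟩
  obtain ⟨k, hk⟩ := h2 F fun j => ⟨ω' j, hω' j⟩
  exact ⟨k, fun j hj => hk ⟨j, hj⟩⟩

variable {μ}

theorem existsUnique_isAlmostSureSpectrum (hd : 1 ≤ d) : ∃! S, D.IsAlmostSureSpectrum μ S := by
  obtain ⟨ω, hω⟩ := (D.ae_isGeneric μ hd).exists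
  refine ⟨D.spec ω, ⟨spectrum.isClosed _, ?_⟩, ?_⟩
  · filter_upwards [D.ae_isGeneric μ hd] with ω' hω'
    exact hω'.spec_eq D hω
  · rintro S ⟨-, hS⟩
    obtain ⟨ω', h1, h2⟩ := (hS.and (D.ae_isGeneric μ hd)).exists
    rw [← h1, h2.spec_eq D hω]

theorem IsAlmostSureSpectrum.exists_isGeneric (hd : 1 ≤ d) {S : Set ℝ}
    (hS : D.IsAlmostSureSpectrum μ S) : ∃ ω, D.IsGeneric μ ω ∧ D.spec ω = S :=
  ((D.ae_isGeneric μ hd).and hS.2).exists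

end Model


/-! ### Quadratic forms and Neumann bracketing -/

/-- The number `2d` of nearest neighbours of a site. -/
def coordination (d : ℕ) : ℝ := ((neighbors (0 : Lattice d)).card : ℝ)

/-- The sum of the squared differences of `x` along the bonds from `n` to sites of `Λ`. -/
def gradSq (Λ : Finset (Lattice d)) (x : Lattice d → ℝ) (n : Lattice d) : ℝ :=
  ∑ m ∈ (neighbors n).filter (fun m => m ∈ Λ), (x m - x n) ^ 2

/-- The quadratic form of the Neumann Schrödinger operator on `Λ`. -/
def neumannForm (Λ : Finset (Lattice d)) (W : Lattice d → ℝ) (x : Lattice d → ℝ) : ℝ :=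
  ∑ n ∈ Λ, (gradSq Λ x n / 2 + (W n - coordination d) * x n ^ 2)

/-- The Neumann Schrödinger operator on `Λ`, acting on lattice functions. -/
def neumannApply (Λ : Finset (Lattice d)) (W : Lattice d → ℝ) (x : Lattice d → ℝ)
    (n : Lattice d) : ℝ :=
  ∑ m ∈ (neighbors n).filter (fun m => m ∈ Λ), (x n - x m) + (W n - coordination d) * x n

theorem neumannSchrodinger_mulVec (Λ : Finset (Lattice d)) (W x : Lattice d → ℝ) (n : Λ) :
    (neumannSchrodinger Λ W).mulVec (fun i => x i) n = neumannApply Λ W x n := by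
  -- Neighbours inside and outside `Λ` together number `2d`. The edge-counting term thus turns the
  -- truncated Laplacian into a graph Laplacian minus `2d`.
  have hc : ((((neighbors n.1).filter (fun m => m ∈ Λ)).card : ℕ) : ℝ) + edgeCount Λ n.1 =
      coordination d := by
    rw [edgeCount, coordination, ← Nat.cast_add, Finset.card_filter_add_card_filter_not,
      card_neighbors]
  have hsum : ∑ j : Λ, (if norm1 (n.1 - j.1) = 1 then (-1 : ℝ) else 0) * x j =
      -∑ m ∈ (neighbors n.1).filter (fun m => m ∈ Λ), x m := by
    rw [Finset.sum_coe_sort Λ fun j => (if norm1 (n.1 - j) = 1 then (-1 : ℝ) else 0) * x j,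
      ← Finset.sum_neg_distrib]
    simp only [ite_mul, zero_mul, neg_one_mul]
    rw [← Finset.sum_filter]
    refine Finset.sum_congr ?_ fun _ _ => rfl
    ext m
    rw [Finset.mem_filter, Finset.mem_filter, mem_neighbors, norm1_sub_comm, and_comm]
  rw [neumannSchrodinger, neumannLaplacian, Matrix.add_mulVec, Matrix.sub_mulVec, Pi.add_apply,
    Pi.sub_apply, Matrix.mulVec_diagonal, Matrix.mulVec_diagonal, neumannApply,
    Finset.sum_sub_distrib, Finset.sum_const, nsmul_eq_mul, ← hc]
  simp only [Matrix.mulVec, dotProduct, Matrix.of_apply]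
  rw [hsum]
  ring

theorem sum_sum_neighbors_comm (Λ : Finset (Lattice d)) (f : Lattice d → Lattice d → ℝ) :
    ∑ n ∈ Λ, ∑ m ∈ (neighbors n).filter (fun m => m ∈ Λ), f n m =
      ∑ n ∈ Λ, ∑ m ∈ (neighbors n).filter (fun m => m ∈ Λ), f m n := by
  refine Finset.sum_comm' fun n m => ?_
  simp only [Finset.mem_filter]
  rw [neighbors_comm]
  tauto

/-- Summation by parts: each bond is met from both of its ends, hence the factor `1 / 2` in the
form. -/
theorem sum_mul_neumannApply (Λ : Finset (Lattice d)) (W x : Lattice d → ℝ) :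
    ∑ n ∈ Λ, x n * neumannApply Λ W x n = neumannForm Λ W x := by
  have h1 := sum_sum_neighbors_comm Λ fun n m => x n * (x n - x m)
  have h2 : ∑ n ∈ Λ, gradSq Λ x n =
      ∑ n ∈ Λ, ∑ m ∈ (neighbors n).filter (fun m => m ∈ Λ), x n * (x n - x m) +
      ∑ n ∈ Λ, ∑ m ∈ (neighbors n).filter (fun m => m ∈ Λ), x m * (x m - x n) := by
    rw [← Finset.sum_add_distrib]
    refine Finset.sum_congr rfl fun n _ => ?_
    rw [← Finset.sum_add_distrib]
    exact Finset.sum_congr rfl fun m _ => by ring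
  have h3 : ∑ n ∈ Λ, x n * neumannApply Λ W x n =
      ∑ n ∈ Λ, ∑ m ∈ (neighbors n).filter (fun m => m ∈ Λ), x n * (x n - x m) +
      ∑ n ∈ Λ, (W n - coordination d) * x n ^ 2 := by
    rw [← Finset.sum_add_distrib]
    refine Finset.sum_congr rfl fun n _ => ?_
    rw [neumannApply, ← Finset.mul_sum]
    ring
  rw [neumannForm, Finset.sum_add_distrib, ← Finset.sum_div, h2, h3, ← h1]
  ring

/-- The variational principle: subtracting its least eigenvalue leaves a positive semidefinite
matrix. -/
theorem groundEnergy_mul_le (Λ : Finset (Lattice d)) (W x : Lattice d → ℝ) :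
    groundEnergy Λ W * ∑ n ∈ Λ, x n ^ 2 ≤ neumannForm Λ W x := by
  rcases Λ.eq_empty_or_nonempty with rfl | hΛ
  · simp [neumannForm]
  have hpsd : (neumannSchrodinger Λ W - algebraMap ℝ _ (groundEnergy Λ W)).PosSemidef := by
    rw [Matrix.posSemidef_iff_isHermitian_and_spectrum_nonneg]
    refine ⟨(neumannSchrodinger_isHermitian Λ W).sub ?_, ?_⟩
    · rw [Matrix.algebraMap_eq_diagonal]
      exact Matrix.isHermitian_diagonal _
    · rw [← spectrum.sub_singleton_eq]
      rintro _ ⟨a, ha, _, rfl, rfl⟩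
      exact sub_nonneg.2 ((groundEnergy_isLeast Λ hΛ W).2 ha)
  have h := (Matrix.posSemidef_iff_dotProduct_mulVec.1 hpsd).2 fun i => x i
  rw [Matrix.sub_mulVec, dotProduct_sub, sub_nonneg] at h
  convert! h using 1
  · rw [Algebra.algebraMap_eq_smul_one, Matrix.smul_mulVec, Matrix.one_mulVec, dotProduct_smul,
      smul_eq_mul, dotProduct, ← Finset.sum_coe_sort]
    simp [sq]
  · rw [← sum_mul_neumannApply, ← Finset.sum_coe_sort, dotProduct]
    simp [neumannSchrodinger_mulVec]

theorem exists_groundState {Λ : Finset (Lattice d)} (hΛ : Λ.Nonempty) (W : Lattice d → ℝ) :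
    ∃ x : Lattice d → ℝ, (∃ n ∈ Λ, x n ≠ 0) ∧
      ∀ n ∈ Λ, neumannApply Λ W x n = groundEnergy Λ W * x n := by
  classical
  have h := (groundEnergy_isLeast Λ hΛ W).1
  rw [spectrum.mem_iff, Matrix.isUnit_iff_isUnit_det, isUnit_iff_ne_zero, not_not,
    ← Matrix.exists_mulVec_eq_zero_iff] at h
  obtain ⟨v, hv, hmul⟩ := h
  let x : Lattice d → ℝ := fun n => if hn : n ∈ Λ then v ⟨n, hn⟩ else 0
  have hx : (fun i : Λ => x i) = v := by
    funext i
    simp [x]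
  refine ⟨x, ?_, fun n hn => ?_⟩
  · obtain ⟨i, hi⟩ := Function.ne_iff.1 hv
    refine ⟨i, i.2, ?_⟩
    rw [← hx] at hi
    exact hi
  · have := congrFun hmul ⟨n, hn⟩
    rw [← hx, Matrix.sub_mulVec, Pi.sub_apply, neumannSchrodinger_mulVec,
      Algebra.algebraMap_eq_smul_one, Matrix.smul_mulVec, Matrix.one_mulVec, Pi.zero_apply,
      sub_eq_zero] at this
    exact this.symm

theorem summable_schr_terms {u : Lattice d → ℝ} (hu : u.support.Finite) (f : Lattice d → ℝ)
    (hf : ∀ n, u n = 0 → (∀ v ∈ neighbors (0 : Lattice d), u (n + v) = 0) → f n = 0) :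
    Summable f := by
  refine summable_of_hasFiniteSupport ((hu.union (hu.biUnion fun m _ =>
    (neighbors m).finite_toSet)).subset fun n hn => ?_)
  by_contra h
  simp only [Set.mem_union, Set.mem_iUnion, not_or, not_exists, Function.mem_support,
    not_not] at h
  refine hn (hf n h.1 fun v hv => ?_)
  by_contra hne
  refine h.2 _ hne ?_
  rw [Finset.mem_coe, neighbors_comm, mem_neighbors, add_sub_cancel_left]
  rw [mem_neighbors, sub_zero] at hv
  exact hv

/-- The energy of `u` as a sum over bonds. -/
theorem tsum_mul_schr {V u : Lattice d → ℝ} (hu : u.support.Finite) :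
    ∑' n, u n * schr V u n = ∑' n, (∑ v ∈ neighbors (0 : Lattice d), (u (n + v) - u n) ^ 2 / 2 +
      (V n - coordination d) * u n ^ 2) := by
  have hshift : ∑' n, ∑ v ∈ neighbors (0 : Lattice d), u (n + v) ^ 2 =
      ∑' n, ∑ v ∈ neighbors (0 : Lattice d), u n ^ 2 := by
    rw [Summable.tsum_finsetSum (f := fun v n => u (n + v) ^ 2)
        fun v _ => (summable_sq hu).comp_injective (add_left_injective v),
      Summable.tsum_finsetSum fun v _ => summable_sq hu]
    exact Finset.sum_congr rfl fun v _ => (Equiv.addRight v).tsum_eq fun n => u n ^ 2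
  have h1 : Summable fun n => ∑ v ∈ neighbors (0 : Lattice d), u (n + v) ^ 2 :=
    summable_schr_terms hu _ fun n _ h => Finset.sum_eq_zero fun v hv => by simp [h v hv]
  have h2 : Summable fun n => ∑ v ∈ neighbors (0 : Lattice d), u n ^ 2 :=
    summable_schr_terms hu _ fun n h _ => by simp [h]
  have h3 : Summable fun n => u n * schr V u n :=
    summable_schr_terms hu _ fun n h _ => by simp [h]
  -- The pointwise discrepancy between the two energy densities; its sum vanishes by translation
  -- invariance.
  have hshift' : ∑' n, ∑ v ∈ neighbors (0 : Lattice d), (u (n + v) ^ 2 / 2 - u n ^ 2 / 2) = 0 := by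
    have : ∀ n, ∑ v ∈ neighbors (0 : Lattice d), (u (n + v) ^ 2 / 2 - u n ^ 2 / 2) =
        (∑ v ∈ neighbors (0 : Lattice d), u (n + v) ^ 2) / 2 -
        (∑ v ∈ neighbors (0 : Lattice d), u n ^ 2) / 2 := fun n => by
      rw [Finset.sum_sub_distrib, Finset.sum_div, Finset.sum_div]
    simp only [this]
    rw [(h1.div_const 2).tsum_sub (h2.div_const 2), tsum_div_const, tsum_div_const, hshift,
      sub_self]
  rw [← add_zero (∑' n, u n * schr V u n), ← hshift', ← h3.tsum_add]
  · refine tsum_congr fun n => ?_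
    rw [schr, sum_neighbors, coordination, sub_mul, ← nsmul_eq_mul, ← Finset.sum_const, mul_add,
      mul_neg, Finset.mul_sum, ← sub_eq_zero]
    have e : ∑ v ∈ neighbors (0 : Lattice d), (u (n + v) - u n) ^ 2 / 2 =
      ∑ v ∈ neighbors (0 : Lattice d), (u (n + v) ^ 2 / 2 - u n ^ 2 / 2) +
      ∑ v ∈ neighbors (0 : Lattice d), u n ^ 2 - ∑ v ∈ neighbors (0 : Lattice d), u n * u (n + v) := by
      rw [← Finset.sum_add_distrib, ← Finset.sum_sub_distrib]
      exact Finset.sum_congr rfl fun v _ => by ring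
    rw [e]
    ring
  · refine summable_schr_terms hu _ fun n h h' => Finset.sum_eq_zero fun v hv => ?_
    simp [h, h' v hv]

theorem gradSq_eq (Λ : Finset (Lattice d)) (x : Lattice d → ℝ) (n : Lattice d) :
    gradSq Λ x n = ∑ v ∈ neighbors (0 : Lattice d),
      if n + v ∈ Λ then (x (n + v) - x n) ^ 2 else 0 := by
  rw [gradSq, Finset.sum_filter, sum_neighbors]

namespace Model

variable (D : Model d)

theorem box_nonempty : D.box.Nonempty :=
  ⟨fun _ => 1, D.mem_box.2 fun i => ⟨le_rfl, D.M_pos i⟩⟩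

/-- Neumann bracketing. -/
theorem mul_tsum_sq_le {E : ℝ} (hE : ∀ a, E ≤ D.E0 a) (ω : D.Config) {u : Lattice d → ℝ}
    (hu : u.support.Finite) :
    E * ∑' n, u n ^ 2 ≤ ∑' n, u n * schr (D.potential ω) u n := by
  set V := D.potential ω
  set g : Lattice d → ℝ := fun n => ∑ v ∈ neighbors (0 : Lattice d), (u (n + v) - u n) ^ 2 / 2 +
      (V n - coordination d) * u n ^ 2
  have hg : Summable g := summable_schr_terms hu _ fun n h h' => by
    simp only [g, h]
    rw [Finset.sum_eq_zero fun v hv => by simp [h' v hv]]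
    simp
  have hsq := (summable_sq hu).mul_left E
  have hg' : Summable (g ∘ D.tileEquiv) := D.tileEquiv.summable_iff.2 hg
  have hsq' : Summable ((fun n => E * u n ^ 2) ∘ D.tileEquiv) := D.tileEquiv.summable_iff.2 hsq
  rw [tsum_mul_schr hu, ← tsum_mul_left, ← D.tileEquiv.tsum_eq,
    ← D.tileEquiv.tsum_eq (f := g)]
  change ∑' p, ((fun n => E * u n ^ 2) ∘ D.tileEquiv) p ≤ ∑' p, (g ∘ D.tileEquiv) p
  rw [hg'.tsum_prod, hsq'.tsum_prod]
  refine hsq'.prod.tsum_le_tsum (fun k => ?_) hg'.prod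
  rw [tsum_fintype, tsum_fintype]
  set x : Lattice d → ℝ := fun p => u (p + D.origin k)
  calc ∑ p : D.box, E * u (p.1 + D.origin k) ^ 2
      = E * ∑ p ∈ D.box, x p ^ 2 := by
        rw [Finset.mul_sum]
        exact Finset.sum_coe_sort D.box fun p => E * x p ^ 2
    _ ≤ D.E0 (ω k) * ∑ p ∈ D.box, x p ^ 2 :=
        mul_le_mul_of_nonneg_right (hE _) (Finset.sum_nonneg fun _ _ => sq_nonneg _)
    _ ≤ neumannForm D.box (D.translate (ω k).1) x := groundEnergy_mul_le _ _ _
    _ ≤ ∑ p ∈ D.box, g (p + D.origin k) := ?_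
    _ = ∑ p : D.box, g (p.1 + D.origin k) := (Finset.sum_coe_sort _ _).symm
  refine Finset.sum_le_sum fun p hp => ?_
  simp only [g, V, D.potential_add_origin hp, x]
  -- The potential terms agree on each tile. The bonds leaving the tile are absent on the left and
  -- nonnegative on the right.
  refine add_le_add ?_ le_rfl
  rw [gradSq_eq, Finset.sum_div]
  refine Finset.sum_le_sum fun v _ => ?_
  rw [add_right_comm]
  split_ifs
  · exact le_rfl
  · rw [zero_div]
    positivity

/-- With `η = E - E' > 0`, the form bound gives `⟨u, (h - E')u⟩ ≥ η ‖u‖²`, which is incompatible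
with `‖(h - E')u‖² ≤ (η² / 2) ‖u‖²` for `u ≠ 0`. -/
theorem le_of_mem_spec {E : ℝ} (hE : ∀ a, E ≤ D.E0 a) {ω : D.Config} {E' : ℝ}
    (h : E' ∈ D.spec ω) : E ≤ E' := by
  rw [mem_spec_iff] at h
  by_contra! hlt
  obtain ⟨u, hfin, hne, hle⟩ := h ((E - E') ^ 2 / 2) (by nlinarith)
  have hp : 0 < ∑' n, u n ^ 2 := by
    obtain ⟨n, hn⟩ := Function.ne_iff.1 hne
    refine (summable_sq hfin).tsum_pos (fun n => sq_nonneg _) n ?_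
    have : u n ≠ 0 := hn
    positivity
  have h1 := D.mul_tsum_sq_le hE ω hfin
  have hs1 : Summable fun n => u n * schr (D.potential ω) u n :=
    summable_schr_terms hfin _ fun n h _ => by simp [h]
  have hs2 := summable_sq hfin
  have hs3 := summable_sq (finite_support_schr_sub (V := D.potential ω) E' hfin)
  have hη : 0 < E - E' := by linarith
  -- Summed form of `2 s t ≤ s² + t²` with `s = η u` and `t = (h - E')u`.
  have h2 : 2 * (E - E') * (∑' n, u n * schr (D.potential ω) u n - E' * ∑' n, u n ^ 2) ≤
      (E - E') ^ 2 * ∑' n, u n ^ 2 + ∑' n, (schr (D.potential ω) u n - E' * u n) ^ 2 := by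
    rw [← tsum_mul_left, ← tsum_mul_left, ← hs1.tsum_sub (hs2.mul_left _), ← tsum_mul_left,
      ← (hs2.mul_left _).tsum_add hs3]
    refine ((hs1.sub (hs2.mul_left _)).mul_left _).tsum_le_tsum (fun n => ?_)
      ((hs2.mul_left _).add hs3)
    nlinarith [sq_nonneg ((E - E') * u n - (schr (D.potential ω) u n - E' * u n))]
  have h3 := mul_le_mul_of_nonneg_left h1 hη.le
  have h4 : 0 < (E - E') ^ 2 * ∑' n, u n ^ 2 := by positivity
  nlinarith

end Model


/-! ### The box energy is minimal at a corner -/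

theorem mem_neighbors_zero_iff {v : Lattice d} :
    v ∈ neighbors (0 : Lattice d) ↔ ∃ i s, (s = 1 ∨ s = -1) ∧ v = Pi.single i s := by
  rw [mem_neighbors, sub_zero, norm1]
  constructor
  · intro h
    obtain ⟨i, hi⟩ : ∃ i, v i ≠ 0 := by
      by_contra! hcon
      simp [hcon] at h
    rw [← Finset.add_sum_erase _ _ (Finset.mem_univ i)] at h
    have h1 : 0 < |v i| := abs_pos.2 hi
    have h2 : 0 ≤ ∑ j ∈ Finset.univ.erase i, |v j| := Finset.sum_nonneg fun _ _ => abs_nonneg _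
    have h3 : ∑ j ∈ Finset.univ.erase i, |v j| = 0 := by omega
    rw [Finset.sum_eq_zero_iff_of_nonneg fun _ _ => abs_nonneg _] at h3
    refine ⟨i, v i, ?_, ?_⟩
    · rcases abs_cases (v i) with h | h <;> omega
    · funext j
      by_cases hj : j = i
      · subst hj
        simp
      · rw [Pi.single_eq_of_ne hj]
        exact abs_eq_zero.1 (h3 j (Finset.mem_erase.2 ⟨hj, Finset.mem_univ _⟩))
  · rintro ⟨i, s, hs, rfl⟩
    rw [Finset.sum_eq_single i]
    · rcases hs with rfl | rfl <;> simp
    · intro j _ hj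
      simp [Pi.single_eq_of_ne hj]
    · simp

namespace Model

variable (D : Model d)

theorem q_eq_zero {x : Lattice d} {i : Fin d} (h : x i < 1 ∨ D.b i < x i) : D.q x = 0 := by
  by_contra hne
  have := D.support_q x hne i
  omega

/-- The displacement obtained from `a` by setting the coordinate `i` to `t`. -/
def move (a : D.Displacement) (i : Fin d) (t : ℤ) (ht : 0 ≤ t ∧ t ≤ (D.M i : ℤ) - D.b i) :
    D.Displacement :=
  ⟨Function.update a.1 i t, by
    constructor
    · intro j
      rcases eq_or_ne j i with rfl | hj
      · simpa using ht.1
      · simpa [hj] using a.2.1 j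
    · intro j
      rcases eq_or_ne j i with rfl | hj
      · simpa using ht.2
      · simpa [hj] using a.2.2 j⟩

/-- Shift by `s` in direction `i`, clamped to the box. -/
def slide (i : Fin d) (s : ℤ) (n : Lattice d) : Lattice d :=
  Function.update n i (max 1 (min (D.M i : ℤ) (n i + s)))

theorem slide_self (i : Fin d) (s : ℤ) (n : Lattice d) :
    D.slide i s n i = max 1 (min (D.M i : ℤ) (n i + s)) := by
  simp [slide]

theorem slide_of_ne {i j : Fin d} (h : j ≠ i) (s : ℤ) (n : Lattice d) :
    D.slide i s n j = n j := by
  simp [slide, h]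

theorem slide_mem_box {i : Fin d} {s : ℤ} {n : Lattice d} (hn : n ∈ D.box) :
    D.slide i s n ∈ D.box := by
  rw [mem_box] at hn ⊢
  intro j
  rcases eq_or_ne j i with rfl | hj
  · have := D.M_pos j
    rw [slide_self]
    omega
  · rw [slide_of_ne _ hj]
    exact hn j

theorem slide_add_neighbor (i : Fin d) (s : ℤ) (n : Lattice d) {v : Lattice d}
    (hv : v ∈ neighbors (0 : Lattice d)) :
    D.slide i s (n + v) = D.slide i s n ∨ D.slide i s (n + v) = D.slide i s n + v := by
  obtain ⟨j, t, ht, rfl⟩ := mem_neighbors_zero_iff.1 hv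
  rcases eq_or_ne j i with rfl | hj
  · have h : D.slide j s (n + Pi.single j t) j = D.slide j s n j ∨
        D.slide j s (n + Pi.single j t) j = D.slide j s n j + t := by
      rw [slide_self, slide_self, Pi.add_apply, Pi.single_eq_same]
      omega
    refine h.imp (fun h => ?_) (fun h => ?_)
    · funext l
      rcases eq_or_ne l j with rfl | hl
      · exact h
      · simp [slide_of_ne, hl]
    · funext l
      rcases eq_or_ne l j with rfl | hl
      · simpa using h
      · simp [slide_of_ne, hl]
  · right
    funext l
    rcases eq_or_ne l i with rfl | hl
    · simp [slide_self, hj.symm]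
    · simp [slide_of_ne, hl]

/-- Clamping either collapses a bond or carries it to a bond in the same direction, so no gradient
term is created. -/
theorem gradSq_slide_le {i : Fin d} {s : ℤ} {n : Lattice d} (x : Lattice d → ℝ) :
    gradSq D.box (fun m => x (D.slide i s m)) n ≤ gradSq D.box x (D.slide i s n) := by
  rw [gradSq_eq, gradSq_eq]
  refine Finset.sum_le_sum fun v hv => ?_
  by_cases h : n + v ∈ D.box
  · rw [if_pos h]
    rcases D.slide_add_neighbor i s n hv with he | he
    · rw [he, sub_self, zero_pow two_ne_zero]
      split_ifs <;> positivity
    · rw [if_pos (he ▸ D.slide_mem_box h), he]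
  · rw [if_neg h]
    split_ifs <;> positivity

/-- Sliding up omits the first layer and counts the last one twice; sliding down does the opposite.
Together every site is counted twice. -/
theorem sum_slide (i : Fin d) (F : Lattice d → ℝ) :
    ∑ n ∈ D.box, F (D.slide i 1 n) + ∑ n ∈ D.box, F (D.slide i (-1) n) =
      2 * ∑ n ∈ D.box, F n := by
  have hinv : ∀ {s : ℤ} {n : Lattice d}, n ∈ D.box → 1 ≤ n i + s → n i + s ≤ D.M i →
      D.slide i (-s) (D.slide i s n) = n := by
    intro s n hn h1 h2
    have := D.mem_box.1 hn i
    funext j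
    rcases eq_or_ne j i with rfl | hj
    · rw [slide_self, slide_self]
      omega
    · rw [slide_of_ne _ hj, slide_of_ne _ hj]
  have hfix : ∀ {s : ℤ} {n : Lattice d}, max 1 (min (D.M i : ℤ) (n i + s)) = n i →
      D.slide i s n = n := by
    intro s n h
    rw [slide, h, Function.update_eq_self]
  have e1 : ∑ n ∈ D.box with n i < (D.M i : ℤ), F (D.slide i 1 n) = ∑ n ∈ D.box with 1 < n i, F n := by
    refine Finset.sum_bij' (fun n _ => D.slide i 1 n) (fun n _ => D.slide i (-1) n)
      ?_ ?_ ?_ ?_ ?_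
    · intro n hn
      obtain ⟨hn, h⟩ := Finset.mem_filter.1 hn
      have := D.mem_box.1 hn i
      refine Finset.mem_filter.2 ⟨D.slide_mem_box hn, ?_⟩
      rw [slide_self]
      omega
    · intro n hn
      obtain ⟨hn, h⟩ := Finset.mem_filter.1 hn
      have := D.mem_box.1 hn i
      refine Finset.mem_filter.2 ⟨D.slide_mem_box hn, ?_⟩
      rw [slide_self]
      omega
    · intro n hn
      obtain ⟨hn, h⟩ := Finset.mem_filter.1 hn
      have := D.mem_box.1 hn i
      exact hinv hn (by omega) (by omega)
    · intro n hn
      obtain ⟨hn, h⟩ := Finset.mem_filter.1 hn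
      have := D.mem_box.1 hn i
      have := hinv (s := -1) hn (by omega) (by omega)
      rwa [neg_neg] at this
    · intro n hn
      rfl
  have e2 : ∑ n ∈ D.box with 1 < n i, F (D.slide i (-1) n) = ∑ n ∈ D.box with n i < (D.M i : ℤ), F n := by
    refine Finset.sum_bij' (fun n _ => D.slide i (-1) n) (fun n _ => D.slide i 1 n)
      ?_ ?_ ?_ ?_ ?_
    · intro n hn
      obtain ⟨hn, h⟩ := Finset.mem_filter.1 hn
      have := D.mem_box.1 hn i
      refine Finset.mem_filter.2 ⟨D.slide_mem_box hn, ?_⟩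
      rw [slide_self]
      omega
    · intro n hn
      obtain ⟨hn, h⟩ := Finset.mem_filter.1 hn
      have := D.mem_box.1 hn i
      refine Finset.mem_filter.2 ⟨D.slide_mem_box hn, ?_⟩
      rw [slide_self]
      omega
    · intro n hn
      obtain ⟨hn, h⟩ := Finset.mem_filter.1 hn
      have := D.mem_box.1 hn i
      have := hinv (s := -1) hn (by omega) (by omega)
      rwa [neg_neg] at this
    · intro n hn
      obtain ⟨hn, h⟩ := Finset.mem_filter.1 hn
      have := D.mem_box.1 hn i
      exact hinv hn (by omega) (by omega)
    · intro n hn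
      rfl
  have e3 : ∑ n ∈ D.box with ¬ n i < (D.M i : ℤ), F (D.slide i 1 n) =
      ∑ n ∈ D.box with ¬ n i < (D.M i : ℤ), F n := by
    refine Finset.sum_congr rfl fun n hn => ?_
    obtain ⟨hn, h⟩ := Finset.mem_filter.1 hn
    have := D.mem_box.1 hn i
    rw [hfix (by omega)]
  have e4 : ∑ n ∈ D.box with ¬ 1 < n i, F (D.slide i (-1) n) =
      ∑ n ∈ D.box with ¬ 1 < n i, F n := by
    refine Finset.sum_congr rfl fun n hn => ?_
    obtain ⟨hn, h⟩ := Finset.mem_filter.1 hn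
    have := D.mem_box.1 hn i
    rw [hfix (by omega)]
  rw [← Finset.sum_filter_add_sum_filter_not D.box (fun n => n i < (D.M i : ℤ))
      fun n => F (D.slide i 1 n),
    ← Finset.sum_filter_add_sum_filter_not D.box (fun n => 1 < n i)
      fun n => F (D.slide i (-1) n), e1, e2, e3, e4]
  have h1 := Finset.sum_filter_add_sum_filter_not D.box (fun n => n i < (D.M i : ℤ)) F
  have h2 := Finset.sum_filter_add_sum_filter_not D.box (fun n => 1 < n i) F
  linarith

/-- For an interior displacement `q_a` vanishes on both end layers, so the clamped sites, where the
moved potential vanishes as well, cause no error. -/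
theorem translate_slide {a : D.Displacement} {i : Fin d} (h1 : 1 ≤ a.1 i)
    (h2 : a.1 i + 1 ≤ (D.M i : ℤ) - D.b i) {s : ℤ} {n : Lattice d} (hn : n ∈ D.box) :
    D.translate (Function.update a.1 i (a.1 i - s)) n = D.translate a.1 (D.slide i s n) := by
  have hni := D.mem_box.1 hn i
  unfold translate
  by_cases h : 1 ≤ n i + s ∧ n i + s ≤ D.M i
  · congr 1
    funext j
    rcases eq_or_ne j i with rfl | hj
    · rw [Pi.sub_apply, Pi.sub_apply, slide_self, Function.update_self]
      omega
    · simp [slide_of_ne, hj]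
  · rw [D.q_eq_zero (i := i), D.q_eq_zero (i := i)]
    · rw [Pi.sub_apply, slide_self]
      omega
    · rw [Pi.sub_apply, Function.update_self]
      omega

theorem neumannForm_slide_le {a : D.Displacement} {i : Fin d} (h1 : 1 ≤ a.1 i)
    (h2 : a.1 i + 1 ≤ (D.M i : ℤ) - D.b i) (x : Lattice d → ℝ) :
    neumannForm D.box (D.translate (Function.update a.1 i (a.1 i - 1)))
        (fun n => x (D.slide i 1 n)) +
      neumannForm D.box (D.translate (Function.update a.1 i (a.1 i - -1)))
        (fun n => x (D.slide i (-1) n)) ≤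
      2 * neumannForm D.box (D.translate a.1) x := by
  have key : ∀ s : ℤ,
      neumannForm D.box (D.translate (Function.update a.1 i (a.1 i - s)))
        (fun n => x (D.slide i s n)) ≤ ∑ n ∈ D.box, (fun n => gradSq D.box x n / 2 +
          (D.translate a.1 n - coordination d) * x n ^ 2) (D.slide i s n) := by
    intro s
    refine Finset.sum_le_sum fun n hn => ?_
    rw [D.translate_slide h1 h2 hn]
    have := D.gradSq_slide_le (i := i) (s := s) (n := n) x
    linarith
  rw [neumannForm.eq_def D.box (D.translate a.1) x, ← D.sum_slide i]
  exact add_le_add (key 1) (key (-1))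

/-- A Neumann eigenfunction that vanishes off the first layer of the box vanishes on the box. -/
theorem eq_zero_of_eigenfunction {W x : Lattice d → ℝ} {E : ℝ} {i : Fin d}
    (hx : ∀ n ∈ D.box, neumannApply D.box W x n = E * x n) (hM : 2 ≤ D.M i)
    (h : ∀ n ∈ D.box, 1 < n i → x n = 0) : ∀ n ∈ D.box, x n = 0 := by
  intro n hn
  by_cases h1 : 1 < n i
  · exact h n hn h1
  have hni := D.mem_box.1 hn i
  have hm : n + Pi.single i 1 ∈ D.box := by
    rw [mem_box]
    intro j
    have hnj := D.mem_box.1 hn j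
    rcases eq_or_ne j i with rfl | hj
    · simp only [Pi.add_apply, Pi.single_eq_same]
      omega
    · simpa [hj] using hnj
  have h0 : x (n + Pi.single i 1) = 0 := h _ hm (by
    simp only [Pi.add_apply, Pi.single_eq_same]
    omega)
  have he := hx _ hm
  rw [neumannApply, h0, mul_zero, mul_zero, add_zero, Finset.sum_filter, sum_neighbors,
    Finset.sum_eq_single (Pi.single i (-1))] at he
  · have e : n + Pi.single i 1 + Pi.single i (-1) = n := by
      rw [add_assoc, ← Pi.single_add]
      simp
    rw [e, if_pos hn] at he
    linarith
  · intro v hv hne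
    split_ifs with hb
    · rw [h _ hb, sub_zero]
      obtain ⟨j, t, ht, rfl⟩ := mem_neighbors_zero_iff.1 hv
      rcases eq_or_ne j i with rfl | hj
      · have : t = 1 := ht.resolve_right (by rintro rfl; exact hne rfl)
        simp only [Pi.add_apply, Pi.single_eq_same]
        omega
      · simp only [Pi.add_apply, Pi.single_eq_same, Pi.single_eq_of_ne hj.symm]
        omega
    · rfl
  · intro hv
    exact absurd (mem_neighbors_zero_iff.2 ⟨i, -1, Or.inr rfl, rfl⟩) hv

/-- At an interior minimiser, moving the potential one step towards the origin does not increase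
the ground state energy. -/
theorem E0_move_sub_one_le {a : D.Displacement} (hmin : ∀ a', D.E0 a ≤ D.E0 a') {i : Fin d}
    (h1 : 1 ≤ a.1 i) (h2 : a.1 i + 1 ≤ (D.M i : ℤ) - D.b i) :
    D.E0 (D.move a i (a.1 i - 1) ⟨by omega, by omega⟩) ≤ D.E0 a := by
  obtain ⟨x, ⟨m, hm, hxm⟩, hx⟩ := exists_groundState D.box_nonempty (D.translate a.1)
  have hb := D.one_le_b i
  have hform : neumannForm D.box (D.translate a.1) x = D.E0 a * ∑ n ∈ D.box, x n ^ 2 := by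
    rw [← sum_mul_neumannApply, Finset.mul_sum]
    refine Finset.sum_congr rfl fun n hn => ?_
    rw [hx n hn, E0]
    ring
  have hle := D.neumannForm_slide_le h1 h2 x
  have hsq := D.sum_slide i fun n => x n ^ 2
  have hf1 := groundEnergy_mul_le D.box (D.translate (Function.update a.1 i (a.1 i - 1)))
    (fun n => x (D.slide i 1 n))
  have hf2 := groundEnergy_mul_le D.box (D.translate (Function.update a.1 i (a.1 i - -1)))
    (fun n => x (D.slide i (-1) n))
  have hE2 : D.E0 a ≤
      groundEnergy D.box (D.translate (Function.update a.1 i (a.1 i - -1))) :=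
    hmin (D.move a i (a.1 i - -1) ⟨by omega, by omega⟩)
  have hS2 : 0 ≤ ∑ n ∈ D.box, x (D.slide i (-1) n) ^ 2 :=
    Finset.sum_nonneg fun _ _ => sq_nonneg _
  -- Otherwise the ground state would live on the first layer alone, the only one lost by sliding,
  -- and the eigenvalue equation on the second layer would make it vanish.
  have hS1 : 0 < ∑ n ∈ D.box, x (D.slide i 1 n) ^ 2 := by
    refine (Finset.sum_nonneg fun _ _ => sq_nonneg _).lt_of_ne' fun h0 => hxm ?_
    rw [Finset.sum_eq_zero_iff_of_nonneg fun _ _ => sq_nonneg _] at h0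
    refine D.eq_zero_of_eigenfunction hx (i := i) (by omega) (fun n hn hni => ?_) m hm
    have hb := D.mem_box.1 hn i
    have := h0 (D.slide i (-1) n) (D.slide_mem_box hn)
    rw [pow_eq_zero_iff two_ne_zero] at this
    convert this
    funext j
    rcases eq_or_ne j i with rfl | hj
    · rw [slide_self, slide_self]
      omega
    · rw [slide_of_ne _ hj, slide_of_ne _ hj]
  have h3 := mul_le_mul_of_nonneg_right hE2 hS2
  -- Minimality of `a` bounds the downward-slid energy, with displacement `a + e_i`, from below.
  -- Subtracting it leaves the required bound on the other trial function.
  have h4 : groundEnergy D.box (D.translate (Function.update a.1 i (a.1 i - 1))) *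
      ∑ n ∈ D.box, x (D.slide i 1 n) ^ 2 ≤ D.E0 a * ∑ n ∈ D.box, x (D.slide i 1 n) ^ 2 := by
    rw [hform] at hle
    have : D.E0 a * (∑ n ∈ D.box, x (D.slide i 1 n) ^ 2) +
      D.E0 a * (∑ n ∈ D.box, x (D.slide i (-1) n) ^ 2) =
      D.E0 a * (2 * ∑ n ∈ D.box, x n ^ 2) := by rw [← hsq, mul_add]
    linarith
  exact le_of_mul_le_mul_right h4 hS1

/-- Reflection of the coordinate `i` about the centre of the box. -/
def flip (i : Fin d) (n : Lattice d) : Lattice d := Function.update n i (D.M i + 1 - n i)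

theorem flip_flip (i : Fin d) (n : Lattice d) : D.flip i (D.flip i n) = n := by
  simp [flip]

theorem flip_mem_box {i : Fin d} {n : Lattice d} : D.flip i n ∈ D.box ↔ n ∈ D.box := by
  rw [mem_box, mem_box]
  refine forall_congr' fun j => ?_
  rcases eq_or_ne j i with rfl | hj
  · simp only [flip, Function.update_self]
    omega
  · simp [flip, hj]

theorem norm1_flip_sub (i : Fin d) (n m : Lattice d) :
    norm1 (D.flip i m - D.flip i n) = norm1 (m - n) := by
  refine Finset.sum_congr rfl fun j _ => ?_
  rcases eq_or_ne j i with rfl | hj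
  · simp only [flip, Pi.sub_apply, Function.update_self]
    rw [← abs_neg]
    congr 1
    ring
  · simp [flip, hj]

theorem sum_flip (i : Fin d) (F : Lattice d → ℝ) :
    ∑ n ∈ D.box, F (D.flip i n) = ∑ n ∈ D.box, F n :=
  Finset.sum_bij' (fun n _ => D.flip i n) (fun n _ => D.flip i n)
    (fun _ h => D.flip_mem_box.2 h) (fun _ h => D.flip_mem_box.2 h)
    (fun _ _ => D.flip_flip i _) (fun _ _ => D.flip_flip i _) fun _ _ => rfl

theorem gradSq_flip (i : Fin d) (x : Lattice d → ℝ) (n : Lattice d) :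
    gradSq D.box (fun m => x (D.flip i m)) n = gradSq D.box x (D.flip i n) := by
  refine Finset.sum_bij' (fun n _ => D.flip i n) (fun n _ => D.flip i n) ?_ ?_
    (fun _ _ => D.flip_flip i _) (fun _ _ => D.flip_flip i _) fun _ _ => rfl
  · intro m hm
    rw [Finset.mem_filter, mem_neighbors] at hm ⊢
    rwa [norm1_flip_sub, flip_mem_box]
  · intro m hm
    rw [Finset.mem_filter, mem_neighbors] at hm ⊢
    rwa [← D.norm1_flip_sub i, flip_flip, flip_mem_box]

theorem translate_flip (H1 : D.ReflectionSymmetric) (a : D.Displacement) (i : Fin d)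
    (n : Lattice d) :
    D.translate (Function.update a.1 i (D.M i - D.b i - a.1 i)) n =
      D.translate a.1 (D.flip i n) := by
  unfold translate
  rw [H1 _ i]
  congr 1
  funext j
  rcases eq_or_ne j i with rfl | hj
  · simp only [flip, Pi.sub_apply, Function.update_self]
    ring
  · simp [flip, hj]

/-- The reflected ground state is a trial function with the same norm and energy. -/
theorem E0_reflect_le (H1 : D.ReflectionSymmetric) (a : D.Displacement) (i : Fin d) :
    D.E0 (D.move a i (D.M i - D.b i - a.1 i)
      ⟨sub_nonneg.2 (a.2.2 i), sub_le_self _ (a.2.1 i)⟩) ≤ D.E0 a := by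
  obtain ⟨x, ⟨m, hm, hxm⟩, hx⟩ := exists_groundState D.box_nonempty (D.translate a.1)
  have hform : neumannForm D.box (D.translate a.1) x = D.E0 a * ∑ n ∈ D.box, x n ^ 2 := by
    rw [← sum_mul_neumannApply, Finset.mul_sum]
    refine Finset.sum_congr rfl fun n hn => ?_
    rw [hx n hn, E0]
    ring
  have h := groundEnergy_mul_le D.box
    (D.translate (Function.update a.1 i (D.M i - D.b i - a.1 i))) fun n => x (D.flip i n)
  have e : neumannForm D.box (D.translate (Function.update a.1 i (D.M i - D.b i - a.1 i)))
      (fun n => x (D.flip i n)) = neumannForm D.box (D.translate a.1) x := by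
    rw [neumannForm, neumannForm]
    simp only [D.gradSq_flip, D.translate_flip H1]
    exact D.sum_flip i fun n => gradSq D.box x n / 2 +
      (D.translate a.1 n - coordination d) * x n ^ 2
  rw [e, hform, D.sum_flip i fun n => x n ^ 2] at h
  refine le_of_mul_le_mul_right h ?_
  exact Finset.sum_pos' (fun _ _ => sq_nonneg _) ⟨m, hm, by positivity⟩

/-- The displacement `0`. -/
def zeroDisplacement : D.Displacement :=
  ⟨0, fun _ => le_rfl, fun i => sub_nonneg.2 (Int.ofNat_le.2 (D.b_le_M i))⟩

/-- Bubbles tend to the corners. -/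
theorem E0_zero_le (H1 : D.ReflectionSymmetric) (a : D.Displacement) :
    D.E0 D.zeroDisplacement ≤ D.E0 a := by
  -- Induction on the sum of the coordinates, among global minimisers only, since the sliding step
  -- needs minimality.
  have key : ∀ N : ℕ, ∀ a : D.Displacement, (∀ a', D.E0 a ≤ D.E0 a') → ∑ i, a.1 i < N →
      D.E0 D.zeroDisplacement ≤ D.E0 a := by
    intro N
    induction N with
    | zero =>
      intro a _ h
      exact absurd h (not_lt.2 (Finset.sum_nonneg fun i _ => a.2.1 i))
    | succ N ih =>
      intro a hmin hN
      by_cases h0 : ∀ i, a.1 i = 0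
      · rw [show a = D.zeroDisplacement from Subtype.ext (funext h0)]
      push Not at h0
      obtain ⟨i, hi⟩ := h0
      have hi0 : (0 : ℤ) ≤ a.1 i := a.2.1 i
      have hiL : a.1 i ≤ (D.M i : ℤ) - D.b i := a.2.2 i
      -- At the upper end reflection sends the coordinate to `0`; in the interior it drops by one.
      obtain ⟨t, ht, hlt, hle⟩ : ∃ t ht, t < a.1 i ∧ D.E0 (D.move a i t ht) ≤ D.E0 a := by
        rcases hiL.eq_or_lt with heq | hlt
        · exact ⟨_, _, by omega, D.E0_reflect_le H1 a i⟩
        · exact ⟨_, _, by omega, D.E0_move_sub_one_le hmin (i := i) (by omega) (by omega)⟩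
      refine (ih (D.move a i t ht) (fun a' => hle.trans (hmin a')) ?_).trans hle
      have : ∑ j, (D.move a i t ht).1 j < ∑ j, a.1 j := by
        refine Finset.sum_lt_sum (fun j _ => ?_) ⟨i, Finset.mem_univ _, ?_⟩
        · rcases eq_or_ne j i with rfl | hj
          · simpa [move] using hlt.le
          · simp [move, hj]
        · simpa [move] using hlt
      push_cast at hN
      omega
  obtain ⟨a₀, h₀⟩ := Finite.exists_min D.E0
  refine (key ((∑ i, a₀.1 i).toNat + 1) a₀ h₀ ?_).trans (h₀ a)
  push_cast
  omega

end Model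


/-! ### Schnol's theorem for bounded eigenfunctions -/

theorem abs_le_one_of_mem_neighbors_zero {v : Lattice d} (hv : v ∈ neighbors (0 : Lattice d))
    (i : Fin d) : |v i| ≤ 1 := by
  rw [mem_neighbors, sub_zero] at hv
  rw [← hv]
  exact Finset.single_le_sum (f := fun i => |v i|) (fun j _ => abs_nonneg _) (Finset.mem_univ i)

/-- The centred cube of radius `R`. -/
def cube (d R : ℕ) : Finset (Lattice d) := Finset.Icc (fun _ => -(R : ℤ)) (fun _ => (R : ℤ))

theorem mem_cube {R : ℕ} {n : Lattice d} : n ∈ cube d R ↔ ∀ i, |n i| ≤ R := by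
  simp only [cube, Finset.mem_Icc, Pi.le_def, abs_le, forall_and]

theorem cube_subset {R R' : ℕ} (h : R ≤ R') : cube d R ⊆ cube d R' := fun n hn =>
  mem_cube.2 fun i => (mem_cube.1 hn i).trans (by exact_mod_cast h)

theorem add_mem_cube {R : ℕ} {n v : Lattice d} (hn : n ∈ cube d R)
    (hv : v ∈ neighbors (0 : Lattice d)) : n + v ∈ cube d (R + 1) :=
  mem_cube.2 fun i => (abs_add_le _ _).trans (by
    have h1 := mem_cube.1 hn i
    have h2 := abs_le_one_of_mem_neighbors_zero hv i
    push_cast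
    omega)

theorem mem_cube_of_add_mem {R : ℕ} {n v : Lattice d} (hn : n + v ∈ cube d R)
    (hv : v ∈ neighbors (0 : Lattice d)) : n ∈ cube d (R + 1) := by
  simpa using add_mem_cube hn (neg_mem_neighbors_zero.2 hv)

theorem card_cube (d R : ℕ) : (cube d R).card = (2 * R + 1) ^ d := by
  rw [cube, Pi.card_Icc]
  simp only [Int.card_Icc, Finset.prod_const, Finset.card_univ, Fintype.card_fin]
  congr 1
  omega

/-- The `ℓ²` mass of `u` in the cube of radius `R`. -/
def mass (u : Lattice d → ℝ) (R : ℕ) : ℝ := ∑ n ∈ cube d R, u n ^ 2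

theorem mass_mono (u : Lattice d → ℝ) {R R' : ℕ} (h : R ≤ R') : mass u R ≤ mass u R' :=
  Finset.sum_le_sum_of_subset_of_nonneg (cube_subset h) fun _ _ _ => sq_nonneg _

theorem mass_le {u : Lattice d → ℝ} {C : ℝ} (hC : ∀ n, |u n| ≤ C) (R : ℕ) :
    mass u R ≤ C ^ 2 * (2 * R + 1) ^ d := by
  have h : mass u R ≤ ∑ n ∈ cube d R, C ^ 2 :=
    Finset.sum_le_sum fun n _ => sq_le_sq' (abs_le.1 (hC n)).1 (abs_le.1 (hC n)).2
  rw [Finset.sum_const, card_cube, nsmul_eq_mul, mul_comm] at h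
  exact_mod_cast h

theorem tsum_indicator_sq (u : Lattice d → ℝ) (s : Finset (Lattice d)) :
    ∑' n, (if n ∈ s then u n else 0) ^ 2 = ∑ n ∈ s, u n ^ 2 := by
  rw [tsum_eq_sum (s := s) fun n hn => by simp [hn]]
  exact Finset.sum_congr rfl fun n hn => by simp [hn]

/-- Cutting off an eigenfunction causes errors only across the boundary of the cube. One factor `2d`
comes from Cauchy–Schwarz over the neighbours, the other from each shell site being seen from `2d`
directions. -/
theorem tsum_cutoff_le {V u : Lattice d → ℝ} {E : ℝ} (hu : ∀ n, schr V u n = E * u n) (R : ℕ) :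
    ∑' n, (schr V (fun m => if m ∈ cube d (R + 1) then u m else 0) n -
      E * (if n ∈ cube d (R + 1) then u n else 0)) ^ 2 ≤
    coordination d ^ 2 * (mass u (R + 2) - mass u R) := by
  classical
  set w : Lattice d → ℝ := fun m => if m ∈ cube d (R + 1) then u m else 0
  set s := cube d (R + 2) \ cube d R
  set z : Lattice d → ℝ := fun m => if m ∈ s then u m else 0
  have hw : w.support.Finite := (cube d (R + 1)).finite_toSet.subset fun n hn => by
    by_contra h
    exact hn (if_neg h)
  have hz : z.support.Finite := s.finite_toSet.subset fun n hn => by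
    by_contra h
    exact hn (if_neg h)
  have hmass : ∑' n, z n ^ 2 = mass u (R + 2) - mass u R := by
    rw [tsum_indicator_sq, mass, mass, ← Finset.sum_sdiff (cube_subset (by omega : R ≤ R + 2))]
    ring
  -- Inside the cube the error consists of the neighbours cut away, outside of the neighbours kept;
  -- both kinds lie in the shell.
  have hpt : ∀ n, (schr V w n - E * w n) ^ 2 ≤
      coordination d * ∑ v ∈ neighbors (0 : Lattice d), z (n + v) ^ 2 := by
    intro n
    have hn := hu n
    by_cases h : n ∈ cube d (R + 1)
    · have e : schr V w n - E * w n =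
          ∑ v ∈ neighbors (0 : Lattice d), (u (n + v) - w (n + v)) := by
        have hwn : w n = u n := if_pos h
        rw [schr, sum_neighbors] at hn ⊢
        rw [Finset.sum_sub_distrib, hwn]
        linarith
      rw [e]
      refine sq_sum_le_card_mul_sum_sq.trans (mul_le_mul_of_nonneg_left
        (Finset.sum_le_sum fun v hv => ?_) (Nat.cast_nonneg _))
      by_cases hv' : n + v ∈ cube d (R + 1)
      · simp only [w, if_pos hv', sub_self, zero_pow two_ne_zero, sq_nonneg]
      · have : n + v ∈ s := Finset.mem_sdiff.2
          ⟨add_mem_cube h hv, fun hR => hv' (cube_subset (by omega) hR)⟩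
        simp only [w, z, if_neg hv', if_pos this, sub_zero, le_refl]
    · have e : schr V w n - E * w n = ∑ v ∈ neighbors (0 : Lattice d), -w (n + v) := by
        have hwn : w n = 0 := if_neg h
        rw [schr, sum_neighbors, hwn, Finset.sum_neg_distrib]
        ring
      rw [e]
      refine sq_sum_le_card_mul_sum_sq.trans (mul_le_mul_of_nonneg_left
        (Finset.sum_le_sum fun v hv => ?_) (Nat.cast_nonneg _))
      rw [neg_sq]
      by_cases hv' : n + v ∈ cube d (R + 1)
      · have : n + v ∈ s := Finset.mem_sdiff.2
          ⟨cube_subset (by omega) hv', fun hR => h (mem_cube_of_add_mem hR hv)⟩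
        simp only [w, z, if_pos hv', if_pos this, le_refl]
      · simp only [w, if_neg hv', zero_pow two_ne_zero, sq_nonneg]
  have hsum : ∀ v, Summable fun n => z (n + v) ^ 2 := fun v =>
    (summable_sq hz).comp_injective (add_left_injective v)
  have htot : ∑' n, ∑ v ∈ neighbors (0 : Lattice d), z (n + v) ^ 2 =
      coordination d * (mass u (R + 2) - mass u R) := by
    rw [Summable.tsum_finsetSum (f := fun v n => z (n + v) ^ 2) fun v _ => hsum v, ← hmass,
      coordination, ← nsmul_eq_mul, ← Finset.sum_const]
    exact Finset.sum_congr rfl fun v _ => (Equiv.addRight v).tsum_eq fun n => z n ^ 2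
  rw [sq, mul_assoc, ← htot, ← tsum_mul_left]
  exact (summable_sq (finite_support_schr_sub E hw)).tsum_le_tsum hpt
    ((summable_sum fun v _ => hsum v).mul_left _)

/-- Schnol's theorem: a nonzero bounded generalised eigenfunction yields a point of the
spectrum. -/
theorem isApproxEigenvalue_of_bounded {V u : Lattice d → ℝ} {E C : ℝ}
    (hu : ∀ n, schr V u n = E * u n) (hC : ∀ n, |u n| ≤ C) (hne : u ≠ 0) :
    IsApproxEigenvalue V E := by
  intro ε hε
  by_contra! hcon
  obtain ⟨n₀, hn₀⟩ := Function.ne_iff.1 hne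
  obtain ⟨R₀, hR₀⟩ : ∃ R, n₀ ∈ cube d R := by
    refine ⟨∑ i, (n₀ i).natAbs, mem_cube.2 fun i => ?_⟩
    rw [Int.abs_eq_natAbs]
    exact_mod_cast Finset.single_le_sum (f := fun i => (n₀ i).natAbs) (fun _ _ => Nat.zero_le _)
      (Finset.mem_univ i)
  have hn₀' : u n₀ ≠ 0 := hn₀
  have hpos : 0 < mass u R₀ := Finset.sum_pos' (fun _ _ => sq_nonneg _) ⟨n₀, hR₀, by positivity⟩
  -- If the cutoffs are never good approximate eigenfunctions, the mass grows by this factor for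
  -- every two steps in radius; boundedness of `u` allows only polynomial growth.
  set r : ℝ := 1 + ε / (coordination d ^ 2 + 1) with hr
  have hr1 : 1 < r := by
    rw [hr]
    have : 0 < ε / (coordination d ^ 2 + 1) := by positivity
    linarith
  have hstep : ∀ R, R₀ ≤ R → r * mass u R ≤ mass u (R + 2) := by
    intro R hR
    have h1 := hcon (fun m => if m ∈ cube d (R + 1) then u m else 0)
      ((cube d (R + 1)).finite_toSet.subset fun n hn => by
        by_contra h
        exact hn (if_neg h))
      (Function.ne_iff.2 ⟨n₀, by
        rw [if_pos (cube_subset (by omega) hR₀)]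
        exact hn₀⟩)
    rw [tsum_indicator_sq] at h1
    have h2 := tsum_cutoff_le hu R
    have h3 : mass u R ≤ ∑ n ∈ cube d (R + 1), u n ^ 2 := mass_mono u (by omega)
    have h4 : mass u R ≤ mass u (R + 2) := mass_mono u (by omega)
    have h5 : ε * mass u R ≤ (coordination d ^ 2 + 1) * (mass u (R + 2) - mass u R) := by
      have := mul_le_mul_of_nonneg_left h3 hε.le
      nlinarith
    have h6 : ε / (coordination d ^ 2 + 1) * mass u R ≤ mass u (R + 2) - mass u R := by
      rw [div_mul_eq_mul_div, div_le_iff₀ (by positivity), mul_comm (_ - _)]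
      exact h5
    rw [hr]
    linarith
  have hgrow : ∀ k : ℕ, r ^ k * mass u R₀ ≤ mass u (R₀ + 2 * k) := by
    intro k
    induction k with
    | zero => simp
    | succ k ih =>
      have := mul_le_mul_of_nonneg_left ih (by linarith : 0 ≤ r)
      calc r ^ (k + 1) * mass u R₀ = r * (r ^ k * mass u R₀) := by ring
        _ ≤ r * mass u (R₀ + 2 * k) := this
        _ ≤ mass u (R₀ + 2 * k + 2) := hstep _ (by omega)
  -- Chosen so that `2 (R₀ + 2k) + 1 ≤ (2 R₀ + 5) k` for `k ≥ 1`.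
  set K : ℝ := C ^ 2 * (2 * R₀ + 5) ^ d
  have hlim := (tendsto_pow_const_div_const_pow_of_one_lt d hr1).const_mul K
  rw [mul_zero] at hlim
  obtain ⟨k, hk1, hk⟩ := ((Filter.eventually_ge_atTop 1).and
    (hlim.eventually (gt_mem_nhds hpos))).exists
  have hrk : 0 < r ^ k := by positivity
  have h1 := (hgrow k).trans (mass_le hC _)
  have h2 : C ^ 2 * (2 * ((R₀ + 2 * k : ℕ) : ℝ) + 1) ^ d ≤ K * (k : ℝ) ^ d := by
    rw [mul_assoc, ← mul_pow]
    have hk1' : (1 : ℝ) ≤ k := by exact_mod_cast hk1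
    have hR : (0 : ℝ) ≤ R₀ := Nat.cast_nonneg _
    refine mul_le_mul_of_nonneg_left (pow_le_pow_left₀ (by positivity) ?_ _) (sq_nonneg _)
    push_cast
    nlinarith
  rw [← mul_div_assoc, div_lt_iff₀ hrk] at hk
  linarith

/-! ### Unfolding the Neumann ground state by reflections -/

/-- Folding of the integers onto `{1, …, M}` by repeated reflection. -/
def foldCoord (M : ℕ) (x : ℤ) : ℤ :=
  if Even ((x - 1) / M) then x - (x - 1) / M * M else M + 1 - (x - (x - 1) / M * M)

theorem exists_eq_mul_add {M : ℕ} (hM : (0 : ℤ) < M) (x : ℤ) :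
    ∃ k y : ℤ, 1 ≤ y ∧ y ≤ M ∧ x = k * M + y := by
  have h1 := Int.emod_add_mul_ediv (x - 1) M
  have h2 := Int.emod_nonneg (x - 1) hM.ne'
  have h3 := Int.emod_lt_of_pos (x - 1) hM
  exact ⟨(x - 1) / M, (x - 1) % M + 1, by omega, by omega, by linarith⟩

theorem ediv_eq_of_eq_mul_add {M : ℕ} {k y : ℤ} (h1 : 1 ≤ y) (h2 : y ≤ M) :
    (k * M + y - 1) / M = k :=
  (Int.ediv_eq_iff_of_pos (by omega)).2 ⟨by linarith, by linarith⟩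

theorem foldCoord_mul_add {M : ℕ} {k y : ℤ} (h1 : 1 ≤ y) (h2 : y ≤ M) :
    foldCoord M (k * M + y) = if Even k then y else M + 1 - y := by
  rw [foldCoord, ediv_eq_of_eq_mul_add h1 h2, add_sub_cancel_left]

theorem foldCoord_mem {M : ℕ} (hM : (0 : ℤ) < M) (x : ℤ) :
    1 ≤ foldCoord M x ∧ foldCoord M x ≤ M := by
  obtain ⟨k, y, h1, h2, rfl⟩ := exists_eq_mul_add hM x
  rw [foldCoord_mul_add h1 h2]
  split_ifs <;> omega

/-- A step inside a tile becomes a step in the box, reversed in odd tiles. A step across a face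
lands on the mirror image of its starting point, so the folded site stays put. -/
theorem foldCoord_add {M : ℕ} (hM : (0 : ℤ) < M) (x s t : ℤ) (hs : s = 1 ∨ s = -1)
    (ht : t = if Even ((x - 1) / M) then s else -s) :
    foldCoord M (x + s) = if 1 ≤ foldCoord M x + t ∧ foldCoord M x + t ≤ M then
      foldCoord M x + t else foldCoord M x := by
  obtain ⟨k, y, h1, h2, rfl⟩ := exists_eq_mul_add hM x
  rw [ediv_eq_of_eq_mul_add h1 h2] at ht
  rw [foldCoord_mul_add h1 h2]
  by_cases hin : 1 ≤ y + s ∧ y + s ≤ M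
  · rw [add_assoc, foldCoord_mul_add hin.1 hin.2]
    split_ifs at ht ⊢ <;> omega
  · rcases hs with rfl | rfl
    · obtain rfl : y = M := by omega
      rw [show k * (M : ℤ) + M + 1 = (k + 1) * M + 1 by ring, foldCoord_mul_add le_rfl (by omega)]
      simp only [Int.even_add_one]
      split_ifs at ht ⊢ <;> omega
    · obtain rfl : y = 1 := by omega
      rw [show k * (M : ℤ) + 1 + -1 = (k - 1) * M + M by ring, foldCoord_mul_add (by omega) le_rfl]
      simp only [Int.even_sub_one]
      split_ifs at ht ⊢ <;> omega

namespace Model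

variable (D : Model d)

/-- Folding of the lattice onto the box by repeated reflection. -/
def fold (n : Lattice d) : Lattice d := fun i => foldCoord (D.M i) (n i)

/-- Change of the signs of the coordinates of `v` in which the tile of `n` is reflected. -/
def orient (n v : Lattice d) : Lattice d := fun i => if Even (D.tile n i) then v i else -v i

theorem orient_orient (n v : Lattice d) : D.orient n (D.orient n v) = v := by
  funext i
  simp only [orient]
  split_ifs <;> simp

theorem orient_mem {n v : Lattice d} (hv : v ∈ neighbors (0 : Lattice d)) :
    D.orient n v ∈ neighbors (0 : Lattice d) := by
  rw [mem_neighbors, sub_zero] at hv ⊢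
  rw [← hv]
  refine Finset.sum_congr rfl fun i _ => ?_
  simp only [orient]
  split_ifs <;> simp

theorem fold_mem_box (n : Lattice d) : D.fold n ∈ D.box :=
  D.mem_box.2 fun i => foldCoord_mem (D.M_pos i) (n i)

theorem fold_add {n v : Lattice d} (hv : v ∈ neighbors (0 : Lattice d)) :
    D.fold (n + v) =
      if D.fold n + D.orient n v ∈ D.box then D.fold n + D.orient n v else D.fold n := by
  obtain ⟨i, s, hs, rfl⟩ := mem_neighbors_zero_iff.1 hv
  have hne : ∀ j, j ≠ i → D.orient n (Pi.single i s) j = 0 := by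
    intro j hj
    simp [orient, hj]
  have hi : D.orient n (Pi.single i s) i = if Even ((n i - 1) / D.M i) then s else -s := by
    simp [orient, tile]
  have hbox : D.fold n + D.orient n (Pi.single i s) ∈ D.box ↔
      1 ≤ foldCoord (D.M i) (n i) + D.orient n (Pi.single i s) i ∧
        foldCoord (D.M i) (n i) + D.orient n (Pi.single i s) i ≤ D.M i := by
    rw [mem_box]
    refine ⟨fun h => h i, fun h j => ?_⟩
    rcases eq_or_ne j i with rfl | hj
    · exact h
    · rw [Pi.add_apply, hne j hj, add_zero]
      exact foldCoord_mem (D.M_pos j) (n j)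
  funext j
  rcases eq_or_ne j i with rfl | hj
  · have := foldCoord_add (D.M_pos j) (n j) s _ hs hi
    have hl : D.fold (n + Pi.single j s) j = foldCoord (D.M j) (n j + s) := by simp [fold]
    rw [hl, this]
    simp only [← hbox]
    split_ifs <;> rfl
  · have hl : D.fold (n + Pi.single i s) j = D.fold n j := by simp [fold, hj]
    rw [hl]
    split_ifs
    · rw [Pi.add_apply, hne j hj, add_zero]
    · rfl

theorem q_reflect_finset (H1 : D.ReflectionSymmetric) (s : Finset (Fin d)) (x : Lattice d) :
    D.q (fun i => if i ∈ s then D.b i - x i + 1 else x i) = D.q x := by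
  induction s using Finset.induction_on with
  | empty => simp
  | insert i s hi ih =>
    rw [← ih, H1 _ i]
    congr 1
    funext j
    rcases eq_or_ne j i with rfl | hj
    · simp only [Finset.mem_insert, true_or, if_true, hi, if_false, Function.update_self]
      ring
    · simp [hj]

/-- In an odd direction the offset `M i - b i` is the mirror image of the offset `0`, and `q` is
invariant under reflecting any set of coordinates. -/
theorem potential_omegaStar (H1 : D.ReflectionSymmetric) (n : Lattice d) :
    D.potential D.omegaStar n = D.translate D.zeroDisplacement.1 (D.fold n) := by
  rw [potential_eq, translate, translate,
    ← D.q_reflect_finset H1 (Finset.univ.filter fun i => ¬ Even (D.tile n i))]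
  congr 1
  funext i
  have e : D.fold n i = if Even (D.tile n i) then n i - D.tile n i * D.M i
    else D.M i + 1 - (n i - D.tile n i * D.M i) := rfl
  have e' : (D.omegaStar (D.tile n)).1 i =
    if Even (D.tile n i) then 0 else (D.M i : ℤ) - D.b i := rfl
  have e0 : D.zeroDisplacement.1 i = 0 := rfl
  simp only [Finset.mem_filter, Finset.mem_univ, true_and, Pi.sub_apply, e, e', e0, origin]
  split_ifs <;> ring

/-- A neighbour across a face folds back to `p` itself and contributes `x p`, exactly the Neumann
edge correction. -/
theorem schr_comp_fold {x W V : Lattice d → ℝ} {E : ℝ}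
    (hx : ∀ n ∈ D.box, neumannApply D.box W x n = E * x n) (hV : ∀ n, V n = W (D.fold n))
    (n : Lattice d) : schr V (fun m => x (D.fold m)) n = E * x (D.fold n) := by
  set p := D.fold n with hp
  -- The value seen in direction `v` from `p`, with steps out of the box replaced by staying at `p`.
  let g : Lattice d → ℝ := fun v => x (if p + v ∈ D.box then p + v else p)
  have h1 : ∑ v ∈ neighbors (0 : Lattice d), x (D.fold (n + v)) =
      ∑ v ∈ neighbors (0 : Lattice d), g v :=
    Finset.sum_bij' (fun v _ => D.orient n v) (fun v _ => D.orient n v)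
      (fun _ h => D.orient_mem h) (fun _ h => D.orient_mem h)
      (fun _ _ => D.orient_orient n _) (fun _ _ => D.orient_orient n _)
      fun v hv => by rw [D.fold_add hv]
  have h2 : ∑ m ∈ (neighbors p).filter (fun m => m ∈ D.box), (x p - x m) =
      coordination d * x p - ∑ v ∈ neighbors (0 : Lattice d), g v := by
    rw [Finset.sum_filter, sum_neighbors, coordination, ← nsmul_eq_mul, ← Finset.sum_const,
      ← Finset.sum_sub_distrib]
    refine Finset.sum_congr rfl fun v _ => ?_
    simp only [g]
    split_ifs <;> simp
  have h3 := hx p (D.fold_mem_box n)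
  rw [neumannApply, h2] at h3
  rw [schr, sum_neighbors, h1, hV, ← hp, ← h3]
  ring

theorem E0_zero_mem_spec_omegaStar (H1 : D.ReflectionSymmetric) :
    D.E0 D.zeroDisplacement ∈ D.spec D.omegaStar := by
  obtain ⟨x, ⟨m, hm, hxm⟩, hx⟩ :=
    exists_groundState D.box_nonempty (D.translate D.zeroDisplacement.1)
  rw [mem_spec_iff]
  refine isApproxEigenvalue_of_bounded (u := fun n => x (D.fold n)) (C := ∑ n ∈ D.box, |x n|)
    (D.schr_comp_fold hx (D.potential_omegaStar H1)) (fun n => ?_) (Function.ne_iff.2 ⟨m, ?_⟩)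
  · exact Finset.single_le_sum (f := fun n => |x n|) (fun _ _ => abs_nonneg _) (D.fold_mem_box n)
  · have : D.fold m = m := by
      funext i
      have h := D.mem_box.1 hm i
      have := foldCoord_mul_add (M := D.M i) (k := 0) h.1 h.2
      simpa [fold] using this
    rw [this]
    exact hxm

end Model


/-! ### Exchanging the two spectral edges -/

/-- The sign `(-1)^(n₁ + ⋯ + n_d)`. -/
def checkerboard (n : Lattice d) : ℝ := if Even (∑ i, n i) then 1 else -1

theorem checkerboard_sq (n : Lattice d) : checkerboard n ^ 2 = 1 := by
  unfold checkerboard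
  split_ifs <;> norm_num

theorem checkerboard_add {n v : Lattice d} (hv : v ∈ neighbors (0 : Lattice d)) :
    checkerboard (n + v) = -checkerboard n := by
  obtain ⟨i, s, hs, rfl⟩ := mem_neighbors_zero_iff.1 hv
  have h : ∑ j, (n + Pi.single i s : Lattice d) j = ∑ j, n j + s := by
    simp [Finset.sum_add_distrib]
  have hodd : ¬ Even s := by rcases hs with rfl | rfl <;> decide
  unfold checkerboard
  rw [h]
  by_cases h : Even (∑ j, n j) <;> simp [Int.even_add, h, hodd]

/-- The lattice is bipartite: each hop flips the checkerboard sign, so conjugation by it reverses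
the sign of `h₀`. -/
theorem schr_checkerboard (V u : Lattice d → ℝ) (n : Lattice d) :
    schr (fun n => -V n) (fun n => checkerboard n * u n) n = -(checkerboard n * schr V u n) := by
  have : ∑ v ∈ neighbors (0 : Lattice d), checkerboard (n + v) * u (n + v) =
      -(checkerboard n * ∑ v ∈ neighbors (0 : Lattice d), u (n + v)) := by
    rw [Finset.mul_sum, ← Finset.sum_neg_distrib]
    refine Finset.sum_congr rfl fun v hv => ?_
    rw [checkerboard_add hv, neg_mul]
  rw [schr, schr, sum_neighbors, sum_neighbors u, this]
  ring

theorem IsApproxEigenvalue.neg {V : Lattice d → ℝ} {E : ℝ} (h : IsApproxEigenvalue V E) :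
    IsApproxEigenvalue (fun n => -V n) (-E) := by
  intro ε hε
  obtain ⟨u, hfin, hne, hle⟩ := h ε hε
  refine ⟨fun n => checkerboard n * u n, ?_, ?_, ?_⟩
  · exact hfin.subset fun n hn h0 => hn (by change u n = 0 at h0; simp [h0])
  · obtain ⟨n, hn⟩ := Function.ne_iff.1 hne
    refine Function.ne_iff.2 ⟨n, mul_ne_zero (fun h0 => ?_) hn⟩
    have := checkerboard_sq n
    simp [h0] at this
  · have e : ∀ n, (schr (fun n => -V n) (fun n => checkerboard n * u n) n -
        -E * (checkerboard n * u n)) ^ 2 = (schr V u n - E * u n) ^ 2 := by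
      intro n
      rw [schr_checkerboard]
      linear_combination (schr V u n - E * u n) ^ 2 * checkerboard_sq n
    simpa only [e, mul_pow, checkerboard_sq, one_mul] using hle

namespace Model

variable (D : Model d)

/-- The model with single-site potential `-q`. -/
def negate : Model d where
  M := D.M
  b := D.b
  one_le_b := D.one_le_b
  b_le_M := D.b_le_M
  q := fun x => -D.q x
  support_q := fun x hx => D.support_q x fun h => hx (by simp [h])

theorem potential_negate (ω : D.Config) :
    D.negate.potential ω = fun n => -D.potential ω n := by
  funext n
  exact finsum_neg_distrib _

theorem neg_mem_spec_negate {ω : D.Config} {E : ℝ} :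
    -E ∈ D.negate.spec ω ↔ E ∈ D.spec ω := by
  have h1 := D.negate.mem_spec_iff ω (-E)
  rw [potential_negate] at h1
  refine h1.trans (Iff.trans ⟨fun h => ?_, IsApproxEigenvalue.neg⟩ (D.mem_spec_iff ω E).symm)
  simpa using h.neg

theorem reflectionSymmetric_negate (H1 : D.ReflectionSymmetric) :
    D.negate.ReflectionSymmetric := fun x i => congrArg Neg.neg (H1 x i)

theorem E0_zero_le_of_mem_spec (H1 : D.ReflectionSymmetric) {ω : D.Config} {E : ℝ}
    (h : E ∈ D.spec ω) : D.E0 D.zeroDisplacement ≤ E :=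
  D.le_of_mem_spec (D.E0_zero_le H1) h

theorem isLeast_spec_omegaStar (H1 : D.ReflectionSymmetric) :
    IsLeast (D.spec D.omegaStar) (D.E0 D.zeroDisplacement) :=
  ⟨D.E0_zero_mem_spec_omegaStar H1, fun _ h => D.E0_zero_le_of_mem_spec H1 h⟩

theorem isGreatest_spec_omegaStar (H1 : D.ReflectionSymmetric) :
    IsGreatest (D.spec D.omegaStar) (-D.negate.E0 D.negate.zeroDisplacement) := by
  have H1' := D.reflectionSymmetric_negate H1
  refine ⟨?_, fun E h => le_neg.2 (D.negate.E0_zero_le_of_mem_spec H1'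
    (D.neg_mem_spec_negate.2 h))⟩
  rw [← neg_mem_spec_negate, neg_neg]
  exact D.negate.E0_zero_mem_spec_omegaStar H1'

end Model

end DisplacementModel

end

/-! ### Conclusion for generic configurations -/

theorem corollary2p4 {d : ℕ} (hd : 1 ≤ d) (D : DisplacementModel.Model d)
    (μ : MeasureTheory.Measure D.Displacement) [MeasureTheory.IsProbabilityMeasure μ]
    (H1 : D.ReflectionSymmetric) (H2 : D.CornersCharged μ) :
    (∃! S : Set ℝ, D.IsAlmostSureSpectrum μ S) ∧
    (((2 ≤ d ∧ D.SignDefinite) ∨ (d = 1 ∧ ∃ a, D.E0 a ≠ -2)) →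
      ∀ S : Set ℝ, D.IsAlmostSureSpectrum μ S →
        ∃ E : ℝ, IsGLB S E ∧ IsLeast (D.spec D.omegaStar) E) ∧
    (((2 ≤ d ∧ D.SignDefinite) ∨ (d = 1 ∧ ∃ a, D.E0neg a ≠ -2)) →
      ∀ S : Set ℝ, D.IsAlmostSureSpectrum μ S →
        ∃ E : ℝ, IsLUB S E ∧ IsGreatest (D.spec D.omegaStar) E) := by
  refine ⟨D.existsUnique_isAlmostSureSpectrum hd, fun _ S hS => ?_, fun _ S hS => ?_⟩
  · obtain ⟨ω, hω, rfl⟩ := hS.exists_isGeneric D hd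
    have hstar := D.isLeast_spec_omegaStar H1
    refine ⟨_, IsLeast.isGLB ⟨?_, fun E h => D.E0_zero_le_of_mem_spec H1 h⟩, hstar⟩
    exact hω.spec_subset D (D.isCharged_omegaStar H2) hstar.1
  · obtain ⟨ω, hω, rfl⟩ := hS.exists_isGeneric D hd
    have hstar := D.isGreatest_spec_omegaStar H1
    refine ⟨_, IsGreatest.isLUB ⟨?_, fun E h => le_neg.2
      (D.negate.E0_zero_le_of_mem_spec (D.reflectionSymmetric_negate H1)
        (D.neg_mem_spec_negate.2 h))⟩, hstar⟩
    exact hω.spec_subset D (D.isCharged_omegaStar H2) hstar.1
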